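/- For finite sets $M_1,M_2$, a nonempty set $\mathcal F$ of functions $M_1\to M_2$ and $g:M_1\to M_2$, put $\mathrm{app}_{\mathcal F}(g)=\max_{f\in\mathcal F}|\{x\in M_1 : f(x)=g(x)\}|$. For a finite group $G$ let $\mathrm{End}(G)$ be the set of its endomorphisms and $\mathrm{Aff}(G)$ the set of its affine maps $x\mapsto g\varphi(x)$ with $g\in G$, $\varphi\in\mathrm{End}(G)$, and put $$\mathrm{endapp}(G)=\min_{f:G\to G}\mathrm{app}_{\mathrm{End}(G)}(f),\qquad \mathrm{affapp}(G)=\min_{f:G\to G}\mathrm{app}_{\mathrm{Aff}(G)}(f).$$ For a prime $p$ and integers $0\le\lambda_1,\lambda_2\le p-1$, let $J_{p,(\lambda_1,\lambda_2)}$ be the Jonah–Konvisser group, i.e. the group generated by $a_1,a_2,b_1,b_2$ subject to the requirement that all commutators are central and to the relations $$a_1^p=[a_1,b_1],\quad a_2^p=[a_1,b_1^{\lambda_1}b_2^{\lambda_2}],\quad b_1^p=[a_2,b_1b_2],\quad b_2^p=[a_2,b_2],\quad [a_1,a_2]=[b_1,b_2]=1.$$ Write $\log$ for the natural logarithm. Then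 the following hold. (1) Every nontrivial finite group $G$ satisfies $$0\le\mathrm{endapp}(G)\le\Bigl(\frac1{\log 2}+\frac1{\log|G|}\Bigr)\log^2|G|\quad\text{and}\quad 1\le\mathrm{affapp}(G)\le\Bigl(\frac1{\log 2}+\frac2{\log|G|}\Bigr)\log^2|G|.$$ Moreover $\mathrm{endapp}(G)\le\mathrm{affapp}(G)$ for every finite group $G$, and $\mathrm{affapp}(G)=o(|G|)$ as $|G|\to\infty$. (2) There are infinitely many pairwise non-isomorphic finite groups $H$ with $\mathrm{endapp}(H)\ge\log_2|H|$ and $\mathrm{affapp}(H)\ge\log_2|H|+1$; namely, this holds for $H=(\mathbb Z/2\mathbb Z)^r$ (a group of order $2^r$) for every integer $r\ge1$. In particular, $\limsup_{|G|\to\infty}\mathrm{endapp}(G)=\limsup_{|G|\to\infty}\mathrm{affapp}(G)=\infty$. (3) There are infinitely many pairwise non-isomorphic finite groups with $\mathrm{endapp}=0$ and $\mathrm{affapp}=1$; namely, for every odd prime $p$ and every $\lambda_1\in\{0,\dots,p-1\}$ the group $J_{p,(\lambda_1,1)}$ is finite of order $p^8$ and satisfies $\mathrm{endapp}(J_{p,(\lambda_1,1)})=0$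 and $\mathrm{affapp}(J_{p,(\lambda_1,1)})=1$. In particular, $\liminf_{|G|\to\infty}\mathrm{endapp}(G)=0$ and $\liminf_{|G|\to\infty}\mathrm{affapp}(G)=1$. -/

import Mathlib

open Filter Asymptotics
open scoped commutatorElement

universe u

noncomputable section

/-- The `F`-approximability of `g : M₁ → M₂`: the maximum, over `f ∈ F`, of the number of arguments
at which `f` and `g` agree. (For `M₁` finite and `F` nonempty the supremum is a maximum, see
`isGreatest_app`.) -/
def app {M₁ M₂ : Type*} (F : Set (M₁ → M₂)) (g : M₁ → M₂) : ℕ :=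
  sSup ((fun f : M₁ → M₂ => {x : M₁ | f x = g x}.ncard) '' F)

/-- The minimum (worst-case) `F`-approximability between `M₁` and `M₂`: the minimum of `app F g`
over all functions `g : M₁ → M₂`. -/
def minApp {M₁ M₂ : Type*} (F : Set (M₁ → M₂)) : ℕ :=
  sInf (Set.range fun g : M₁ → M₂ => app F g)

theorem isGreatest_app {M₁ M₂ : Type*} [Finite M₁] {F : Set (M₁ → M₂)} (hF : F.Nonempty)
    (g : M₁ → M₂) :
    IsGreatest ((fun f : M₁ → M₂ => {x : M₁ | f x = g x}.ncard) '' F) (app F g) := by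
  have hb : BddAbove ((fun f : M₁ → M₂ => {x : M₁ | f x = g x}.ncard) '' F) := by
    refine ⟨Nat.card M₁, ?_⟩
    rintro _ ⟨f, -, rfl⟩
    exact Set.ncard_le_card _
  exact ⟨Nat.sSup_mem (hF.image _) hb, fun n hn => le_csSup hb hn⟩

theorem isLeast_minApp {M₁ M₂ : Type*} [Nonempty M₂] (F : Set (M₁ → M₂)) :
    IsLeast (Set.range fun g : M₁ → M₂ => app F g) (minApp F) :=
  ⟨Nat.sInf_mem (Set.range_nonempty _), fun _ hn => Nat.sInf_le hn⟩

/-- The endomorphisms of `G`, as functions on `G`. -/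
def endMaps (G : Type*) [Group G] : Set (G → G) :=
  {A | ∃ φ : G →* G, ∀ x, A x = φ x}

/-- The affine maps `x ↦ g * φ x` of `G`, with `g ∈ G` and `φ` an endomorphism of `G`. -/
def affMaps (G : Type*) [Group G] : Set (G → G) :=
  {A | ∃ (g : G) (φ : G →* G), ∀ x, A x = g * φ x}

/-- The minimum endomorphic approximability on `G`. -/
def endApp (G : Type*) [Group G] : ℕ := minApp (endMaps G)

/-- The minimum affine approximability on `G`. -/
def affApp (G : Type*) [Group G] : ℕ := minApp (affMaps G)

/-- The filter on finite groups that expresses `|G| → ∞`. -/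
def orderAtTop : Filter FiniteGrp.{u} := comap (fun G : FiniteGrp.{u} => Nat.card G) atTop

/-- Names for the four generators of the Jonah-Konvisser groups. -/
inductive JKGen : Type
  | a₁ | a₂ | b₁ | b₂

namespace JKGen

/-- The relators of the Jonah-Konvisser group: all double commutators (nilpotency class at most
two), together with the relations
`a₁ ^ p = [a₁, b₁]`, `a₂ ^ p = [a₁, b₁ ^ l₁ * b₂ ^ l₂]`, `b₁ ^ p = [a₂, b₁ * b₂]`,
`b₂ ^ p = [a₂, b₂]`, `[a₁, a₂] = [b₁, b₂] = 1`. -/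
def rels (p l₁ l₂ : ℕ) : Set (FreeGroup JKGen) :=
  let A₁ := FreeGroup.of a₁
  let A₂ := FreeGroup.of a₂
  let B₁ := FreeGroup.of b₁
  let B₂ := FreeGroup.of b₂
  {w | ∃ x y z : FreeGroup JKGen, w = ⁅⁅x, y⁆, z⁆} ∪
    {A₁ ^ p * ⁅A₁, B₁⁆⁻¹,
     A₂ ^ p * ⁅A₁, B₁ ^ l₁ * B₂ ^ l₂⁆⁻¹,
     B₁ ^ p * ⁅A₂, B₁ * B₂⁆⁻¹,
     B₂ ^ p * ⁅A₂, B₂⁆⁻¹,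
     ⁅A₁, A₂⁆,
     ⁅B₁, B₂⁆}

end JKGen

/-- The Jonah-Konvisser group with parameters `p` and `(l₁, l₂)`. -/
abbrev JKGroup (p l₁ l₂ : ℕ) : Type := PresentedGroup (JKGen.rels p l₁ l₂)

end

/-!
Three independent arguments carry the theorem.

*Upper bounds.* Let `F` be a set of functions `G → G` with `|G| = n`. For uniformly random
`g : G → G` the sum over `f ∈ F` of `exp |{x | f x = g x}|` has mean
`|F| (1 + (e - 1) / n) ^ n ≤ |F| exp (e - 1)`, so some `g` agrees with no member of `F` on more than
`log |F| + (e - 1)` arguments (`minApp_le_log_ncard_add`). A finite group is generated by at most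
`log₂ n` elements, whence there are at most `n ^ log₂ n` endomorphisms and at most
`n ^ (log₂ n + 1)` affine maps. Since `e - 1 ≤ log n` for `n ≥ 6`, this gives the bounds; the orders
up to `5` follow from trivial bounds where needed.

*Lower bounds.* On `(ℤ/2ℤ)^r` an endomorphism may be prescribed on a basis, and an affine map on
a basis together with the identity element.

*Jonah–Konvisser groups.* Let `J` be the group with parameters `(l, 1)`, and `p` odd. It is
identified with the module `(ℤ/p²)⁴` under the multiplication `v * w = v + w + p • B v w`, where `B`
is an explicit bilinear form (`TwistedAddition`, `jkForm`, `exists_mulEquiv_jkModel`). In this model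
the `p`-th power map is multiplication by `p`, and the commutator of `v` and `w` is
`p • (B v w - B w v)`. Hence the defining relations, applied to the images of the generators under
an endomorphism, become linear-algebraic equations over the field with `p` elements, whose only
solutions are zero and the standard basis (`JKRelations.eq_zero_or_eq_basis`). So an endomorphism
`φ` maps `J` into the centre or induces the identity on the central quotient
(`endomorphism_reduceModP`). As every central element is a `p`-th power, `φ` is accordingly trivial
or the identity on the centre. The squaring map therefore agrees with every affine map on at most
one argument (`eq_of_endomorphism_eq_sq`): on the central quotient and on the centre alike, doubling
a nonzero vector `v` yields neither `0` nor `v`.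
-/

noncomputable section

/-! ### Agreement numbers -/

section Approximability

variable {M₁ M₂ : Type*}

theorem ncard_le_app [Finite M₁] {F : Set (M₁ → M₂)} {f : M₁ → M₂} (hf : f ∈ F) (g : M₁ → M₂) :
    {x | f x = g x}.ncard ≤ app F g :=
  (isGreatest_app ⟨f, hf⟩ g).2 ⟨f, hf, rfl⟩

theorem exists_ncard_eq_app [Finite M₁] {F : Set (M₁ → M₂)} (hF : F.Nonempty) (g : M₁ → M₂) :
    ∃ f ∈ F, {x | f x = g x}.ncard = app F g :=
  (isGreatest_app hF g).1

theorem app_mono [Finite M₁] {F F' : Set (M₁ → M₂)} (hF : F.Nonempty) (h : F ⊆ F') (g : M₁ → M₂) :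
    app F g ≤ app F' g := by
  obtain ⟨f, hf, hfg⟩ := exists_ncard_eq_app hF g
  exact hfg ▸ ncard_le_app (h hf) g

theorem minApp_le_app (F : Set (M₁ → M₂)) (g : M₁ → M₂) : minApp F ≤ app F g :=
  Nat.sInf_le ⟨g, rfl⟩

theorem exists_app_eq_minApp [Nonempty M₂] (F : Set (M₁ → M₂)) : ∃ g, app F g = minApp F :=
  (isLeast_minApp F).1

/-- Some `g` agrees with no member of `F` on more than `log |F| + (e - 1)` arguments: for uniformly
random `g`, the sum over `f ∈ F` of `exp (number of agreements of f and g)` has mean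
`|F| * (1 + (e - 1) / n) ^ n ≤ |F| * exp (e - 1)`. -/
theorem minApp_le_log_ncard_add [Finite M₁] [Finite M₂] [Nonempty M₂]
    (hcard : Nat.card M₁ = Nat.card M₂) {F : Set (M₁ → M₂)} (hF : F.Nonempty) :
    (minApp F : ℝ) ≤ Real.log F.ncard + (Real.exp 1 - 1) := by
  classical
  have := Fintype.ofFinite M₁
  have := Fintype.ofFinite M₂
  have hfin : F.Finite := Set.toFinite F
  set n : ℕ := Fintype.card M₂ with hn
  have hn1 : Fintype.card M₁ = n := by simpa [Nat.card_eq_fintype_card] using hcard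
  have hn0 : (0 : ℝ) < n := by exact_mod_cast Fintype.card_pos
  let S : Finset (M₁ → M₂) := hfin.toFinset
  have hSc : S.card = F.ncard := (Set.ncard_eq_toFinset_card F hfin).symm
  have hSpos : (0 : ℝ) < S.card := by
    rw [hSc]; exact_mod_cast (Set.ncard_pos hfin).2 hF
  -- `w f g` is the exponential of the number of agreements, as a product over the arguments
  let w : (M₁ → M₂) → (M₁ → M₂) → ℝ :=
    fun f g => ∏ x, if f x = g x then Real.exp 1 else 1
  have hw : ∀ f g, w f g = Real.exp ({x | f x = g x}.ncard : ℝ) := by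
    intro f g
    have : {x | f x = g x}.ncard = (Finset.univ.filter fun x => f x = g x).card := by
      rw [Set.ncard_eq_toFinset_card']; simp
    rw [this, ← Real.exp_one_pow, ← Finset.prod_const, Finset.prod_filter]
  have hsum : ∀ f, ∑ g, w f g = ((n : ℝ) + (Real.exp 1 - 1)) ^ n := by
    intro f
    have h1 : ∑ g : M₁ → M₂, w f g = ∏ x : M₁, ∑ y : M₂, if f x = y then Real.exp 1 else 1 :=
      (Fintype.prod_sum fun (x : M₁) (y : M₂) => if f x = y then Real.exp 1 else (1 : ℝ)).symm
    have h2 : ∀ x : M₁, (∑ y : M₂, if f x = y then Real.exp 1 else (1 : ℝ))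
        = n + (Real.exp 1 - 1) := by
      intro x
      have : ∀ y : M₂, (if f x = y then Real.exp 1 else (1 : ℝ))
          = 1 + if f x = y then Real.exp 1 - 1 else 0 := by
        intro y; split_ifs <;> ring
      simp [this, Finset.sum_add_distrib, hn]
    rw [h1, Finset.prod_congr rfl fun x _ => h2 x, Finset.prod_const, Finset.card_univ, hn1]
  have hpow : ((n : ℝ) + (Real.exp 1 - 1)) ^ n ≤ (n : ℝ) ^ n * Real.exp (Real.exp 1 - 1) := by
    have h := Real.add_one_le_exp ((Real.exp 1 - 1) / n)
    have he : 0 < Real.exp 1 - 1 := by linarith [Real.add_one_lt_exp (one_ne_zero (α := ℝ))]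
    calc ((n : ℝ) + (Real.exp 1 - 1)) ^ n = (n * ((Real.exp 1 - 1) / n + 1)) ^ n := by
          congr 1; field_simp; ring
      _ ≤ (n * Real.exp ((Real.exp 1 - 1) / n)) ^ n := by gcongr
      _ = _ := by
          rw [mul_pow, ← Real.exp_nat_mul]
          congr 2
          field_simp
  -- some `g` is at least as good as the average over all functions
  obtain ⟨g, -, hg⟩ : ∃ g ∈ (Finset.univ : Finset (M₁ → M₂)),
      ∑ f ∈ S, w f g ≤ S.card * Real.exp (Real.exp 1 - 1) := by
    refine Finset.exists_le_of_sum_le Finset.univ_nonempty ?_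
    rw [Finset.sum_comm, Finset.sum_congr rfl fun f _ => hsum f]
    simp only [Finset.sum_const, nsmul_eq_mul, Finset.card_univ, Fintype.card_fun, hn1, ← hn]
    push_cast
    nlinarith [mul_le_mul_of_nonneg_left hpow hSpos.le]
  obtain ⟨f, hf, hfg⟩ := exists_ncard_eq_app hF g
  have hle : Real.exp (app F g : ℝ) ≤ S.card * Real.exp (Real.exp 1 - 1) := by
    rw [← hfg, ← hw]
    refine le_trans ?_ hg
    refine Finset.single_le_sum (f := fun f => w f g) (fun f _ => ?_) (hfin.mem_toFinset.2 hf)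
    rw [hw]; exact (Real.exp_pos _).le
  have hmin : (minApp F : ℝ) ≤ app F g := by exact_mod_cast minApp_le_app F g
  refine hmin.trans ?_
  rw [← hSc, ← Real.log_exp (Real.exp 1 - 1), ← Real.log_mul hSpos.ne' (Real.exp_pos _).ne']
  exact (Real.le_log_iff_exp_le (by positivity)).2 hle

end Approximability

/-! ### Endomorphisms and affine maps of a finite group -/

section Groups

variable (G : Type*) [Group G]

theorem endMaps_nonempty : (endMaps G).Nonempty := ⟨id, MonoidHom.id G, fun _ => rfl⟩

theorem endMaps_subset_affMaps : endMaps G ⊆ affMaps G := by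
  rintro A ⟨φ, h⟩
  exact ⟨1, φ, by simpa using h⟩

theorem affMaps_nonempty : (affMaps G).Nonempty := (endMaps_nonempty G).mono (endMaps_subset_affMaps G)

theorem endApp_le_affApp [Finite G] : endApp G ≤ affApp G := by
  obtain ⟨g, hg⟩ := exists_app_eq_minApp (affMaps G)
  exact (minApp_le_app _ g).trans
    ((app_mono (endMaps_nonempty G) (endMaps_subset_affMaps G) g).trans hg.le)

/-- Constant maps are affine, so every function agrees with some affine map at the identity. -/
theorem one_le_affApp [Finite G] : 1 ≤ affApp G := by
  obtain ⟨g, hg⟩ := exists_app_eq_minApp (affMaps G)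
  rw [affApp, ← hg]
  refine le_trans ?_ (ncard_le_app (F := affMaps G) (f := fun _ => g 1) ⟨g 1, 1, by simp⟩ g)
  exact (Set.ncard_pos (Set.toFinite _)).2 ⟨1, rfl⟩

theorem affApp_le_card [Finite G] : affApp G ≤ Nat.card G := by
  obtain ⟨f, -, hf⟩ := exists_ncard_eq_app (affMaps_nonempty G) id
  exact (minApp_le_app _ id).trans (hf ▸ Set.ncard_le_card _)

/-- A function that does not fix the identity agrees with no endomorphism there. -/
theorem endApp_lt_card [Finite G] [Nontrivial G] : endApp G < Nat.card G := by
  obtain ⟨a, ha⟩ := exists_ne (1 : G)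
  obtain ⟨f, ⟨φ, hφ⟩, hf⟩ := exists_ncard_eq_app (endMaps_nonempty G) fun _ => a
  refine (minApp_le_app _ _).trans_lt (hf ▸ Set.ncard_lt_card ?_)
  intro h
  have : f 1 = a := (Set.eq_univ_iff_forall.1 h) 1
  rw [hφ, map_one] at this
  exact ha this.symm

/-- Adjoining generators one at a time at least doubles the subgroup generated so far. -/
theorem exists_closure_eq_top_two_pow_card_le [Finite G] :
    ∃ S : Finset G, Subgroup.closure (S : Set G) = ⊤ ∧ 2 ^ S.card ≤ Nat.card G := by
  classical
  have key : ∀ (k : ℕ) (T : Finset G), 2 ^ T.card ≤ Nat.card (Subgroup.closure (T : Set G)) →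
      Nat.card G - Nat.card (Subgroup.closure (T : Set G)) ≤ k →
      ∃ S : Finset G, Subgroup.closure (S : Set G) = ⊤ ∧ 2 ^ S.card ≤ Nat.card G := by
    intro k
    induction k with
    | zero =>
      intro T hT hk
      have hle := Subgroup.card_le_card_group (Subgroup.closure (T : Set G))
      exact ⟨T, Subgroup.eq_top_of_le_card _ (by omega), hT.trans hle⟩
    | succ k ih =>
      intro T hT hk
      by_cases htop : Subgroup.closure (T : Set G) = ⊤
      · exact ⟨T, htop, hT.trans (Subgroup.card_le_card_group _)⟩
      obtain ⟨x, hx⟩ : ∃ x, x ∉ Subgroup.closure (T : Set G) := by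
        by_contra! h
        exact htop ((Subgroup.eq_top_iff' _).2 h)
      have hle : Subgroup.closure (T : Set G) ≤ Subgroup.closure (insert x T : Finset G) :=
        Subgroup.closure_mono (by simp)
      have hdvd := Subgroup.card_dvd_of_le hle
      have hpos : 0 < Nat.card (Subgroup.closure ((insert x T : Finset G) : Set G)) := Nat.card_pos
      have hne : Nat.card (Subgroup.closure (T : Set G))
          ≠ Nat.card (Subgroup.closure ((insert x T : Finset G) : Set G)) := by
        intro h
        have := Subgroup.eq_of_le_of_card_ge hle h.ge
        exact hx (this ▸ Subgroup.subset_closure (by simp))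
      have hpos' : 0 < Nat.card (Subgroup.closure (T : Set G)) := Nat.card_pos
      have h2 : 2 * Nat.card (Subgroup.closure (T : Set G))
          ≤ Nat.card (Subgroup.closure ((insert x T : Finset G) : Set G)) := by
        obtain ⟨c, hc⟩ := hdvd
        rw [hc] at hne hpos ⊢
        have : c ≠ 0 := by rintro rfl; simp at hpos
        have : c ≠ 1 := by rintro rfl; simp at hne
        have : 2 ≤ c := by omega
        nlinarith
      refine ih (insert x T) ?_ (by omega)
      calc 2 ^ (insert x T).card ≤ 2 ^ (T.card + 1) :=
            Nat.pow_le_pow_right (by norm_num) (Finset.card_insert_le x T)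
        _ = 2 * 2 ^ T.card := by ring
        _ ≤ _ := (Nat.mul_le_mul_left 2 hT).trans h2
  exact key (Nat.card G) ∅ (by simp) (by omega)

/-- An endomorphism is determined by its values on a generating set. -/
theorem exists_ncard_endMaps_le [Finite G] :
    ∃ d : ℕ, 2 ^ d ≤ Nat.card G ∧ (endMaps G).ncard ≤ Nat.card G ^ d ∧
      (affMaps G).ncard ≤ Nat.card G ^ (d + 1) := by
  obtain ⟨S, hS, hd⟩ := exists_closure_eq_top_two_pow_card_le G
  have hhom : Nat.card (G →* G) ≤ Nat.card G ^ S.card := by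
    have hinj : Function.Injective fun (φ : G →* G) (s : S) => φ s := by
      intro φ ψ h
      refine MonoidHom.eq_of_eqOn_dense hS fun s hs => ?_
      exact congrFun h ⟨s, hs⟩
    refine (Nat.card_le_card_of_injective _ hinj).trans ?_
    rw [Nat.card_fun]; simp
  have : Finite (G →* G) := Finite.of_injective _ DFunLike.coe_injective
  refine ⟨S.card, hd, ?_, ?_⟩
  · have : endMaps G = Set.range fun φ : G →* G => (φ : G → G) := by
      ext A; simp [endMaps, funext_iff, eq_comm]
    rw [this, ← Nat.card_coe_set_eq]
    exact (Finite.card_range_le _).trans hhom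
  · have : affMaps G = Set.range fun q : G × (G →* G) => fun x => q.1 * q.2 x := by
      ext A; simp [affMaps, funext_iff, eq_comm]
    rw [this, ← Nat.card_coe_set_eq]
    refine (Finite.card_range_le _).trans ?_
    rw [Nat.card_prod, pow_succ, mul_comm]
    exact Nat.mul_le_mul_right _ hhom

end Groups

/-! ### Bounds valid for all finite groups -/

section Bounds

/-- From `n = 6` on, the error term of the averaging bound is at most `log n`. -/
theorem exp_one_sub_one_le_log {n : ℕ} (hn : 6 ≤ n) : Real.exp 1 - 1 ≤ Real.log n := by
  have h6 : Real.log 6 = Real.log 2 + Real.log 3 := by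
    rw [← Real.log_mul (by norm_num) (by norm_num)]; norm_num
  have hle : Real.log 6 ≤ Real.log n := Real.log_le_log (by norm_num) (by exact_mod_cast hn)
  linarith [Real.exp_one_lt_d9, Real.log_two_gt_d9, Real.log_three_gt_d9]

theorem log_five_gt : 1.559 < Real.log 5 := by
  have h : 9 * Real.log 2 ≤ 4 * Real.log 5 := by
    have h := Real.log_le_log (x := 2 ^ 9) (y := 5 ^ 4) (by norm_num) (by norm_num)
    rw [Real.log_pow, Real.log_pow] at h
    exact_mod_cast h
  linarith [Real.log_two_gt_d9]

/-- For `n ∈ {4, 5}` even the trivial bound `n` lies below the logarithmic one. -/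
theorem natCast_le_logb_add_one_mul_log {n : ℕ} (h4 : 4 ≤ n) (h5 : n ≤ 5) :
    (n : ℝ) ≤ (Real.log n / Real.log 2 + 1) * Real.log n := by
  have h2 := Real.log_two_gt_d9
  have h2' := Real.log_two_lt_d9
  interval_cases n
  · have : Real.log (4 : ℕ) = 2 * Real.log 2 := by
      rw [show ((4 : ℕ) : ℝ) = 2 ^ 2 by norm_num, Real.log_pow]; norm_num
    rw [this, mul_div_assoc, div_self (by linarith)]
    push_cast; linarith
  · have h := log_five_gt
    have : 2.249 ≤ Real.log 5 / Real.log 2 := by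
      rw [le_div_iff₀ (by linarith)]; linarith
    push_cast
    nlinarith

theorem logb_three_gt : 1.58 < Real.log 3 / Real.log 2 := by
  have h2 := Real.log_two_lt_d9
  rw [lt_div_iff₀ (by linarith [Real.log_two_gt_d9])]
  linarith [Real.log_three_gt_d9]

variable (G : Type*) [Group G] [Finite G] [Nontrivial G]

/-- The averaging bound, with `|End G| ≤ |G| ^ log₂ |G|`. Its error term `e - 1` exceeds the one that
is wanted, `log |G|`, only for `|G| ≤ 5`. -/
theorem endApp_le_and_affApp_le_log_add :
    (endApp G : ℝ) ≤ Real.log (Nat.card G) / Real.log 2 * Real.log (Nat.card G) + (Real.exp 1 - 1) ∧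
    (affApp G : ℝ) ≤ (Real.log (Nat.card G) / Real.log 2 + 1) * Real.log (Nat.card G)
      + (Real.exp 1 - 1) := by
  obtain ⟨d, hd, hE, hA⟩ := exists_ncard_endMaps_le G
  have hn : 2 ≤ Nat.card G := Finite.one_lt_card
  have hlog : 0 < Real.log (Nat.card G) := Real.log_pos (by exact_mod_cast hn)
  have hd' : (d : ℝ) ≤ Real.log (Nat.card G) / Real.log 2 := by
    rw [le_div_iff₀ (Real.log_pos one_lt_two), ← Real.log_pow]
    exact Real.log_le_log (by positivity) (by exact_mod_cast hd)
  have key : ∀ {F : Set (G → G)} {k : ℕ}, F.Nonempty → F.ncard ≤ Nat.card G ^ k →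
      (minApp F : ℝ) ≤ k * Real.log (Nat.card G) + (Real.exp 1 - 1) := by
    intro F k hF hk
    refine (minApp_le_log_ncard_add rfl hF).trans ?_
    have hpos : 0 < F.ncard := (Set.ncard_pos (Set.toFinite F)).2 hF
    rw [← Real.log_pow]
    gcongr
    exact_mod_cast hk
  refine ⟨(key (endMaps_nonempty G) hE).trans ?_, (key (affMaps_nonempty G) hA).trans ?_⟩
  · gcongr
  · push_cast
    gcongr

theorem endApp_le_log :
    (endApp G : ℝ) ≤
      (1 / Real.log 2 + 1 / Real.log (Nat.card G)) * Real.log (Nat.card G) ^ 2 := by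
  have hn : 2 ≤ Nat.card G := Finite.one_lt_card
  have hlog : 0 < Real.log (Nat.card G) := Real.log_pos (by exact_mod_cast hn)
  have hE := (endApp_le_and_affApp_le_log_add G).1
  have hlt := endApp_lt_card G
  have hlt' : (endApp G : ℝ) + 1 ≤ Nat.card G := by exact_mod_cast hlt
  have heq : (1 / Real.log 2 + 1 / Real.log (Nat.card G)) * Real.log (Nat.card G) ^ 2
      = (Real.log (Nat.card G) / Real.log 2 + 1) * Real.log (Nat.card G) := by
    field_simp
  rw [heq]
  generalize Nat.card G = n at *
  rcases le_or_gt 6 n with h6 | h6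
  · linarith [exp_one_sub_one_le_log h6]
  rcases le_or_gt 4 n with h4 | h4
  · linarith [natCast_le_logb_add_one_mul_log h4 (by omega)]
  have h2 := Real.log_two_gt_d9
  interval_cases n
  · push_cast at *
    rw [div_self (by linarith)]
    linarith
  · push_cast at *
    nlinarith [logb_three_gt, Real.log_three_gt_d9]

theorem affApp_le_log :
    (affApp G : ℝ) ≤
      (1 / Real.log 2 + 2 / Real.log (Nat.card G)) * Real.log (Nat.card G) ^ 2 := by
  have hn : 2 ≤ Nat.card G := Finite.one_lt_card
  have hlog : 0 < Real.log (Nat.card G) := Real.log_pos (by exact_mod_cast hn)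
  have hA := (endApp_le_and_affApp_le_log_add G).2
  have hle' : (affApp G : ℝ) ≤ Nat.card G := by exact_mod_cast affApp_le_card G
  have heq : (1 / Real.log 2 + 2 / Real.log (Nat.card G)) * Real.log (Nat.card G) ^ 2
      = (Real.log (Nat.card G) / Real.log 2 + 2) * Real.log (Nat.card G) := by
    field_simp
  rw [heq]
  generalize Nat.card G = n at *
  rcases le_or_gt 6 n with h6 | h6
  · linarith [exp_one_sub_one_le_log h6]
  rcases le_or_gt 4 n with h4 | h4
  · linarith [natCast_le_logb_add_one_mul_log h4 (by omega)]
  have h2 := Real.log_two_gt_d9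
  interval_cases n
  · push_cast at *
    rw [div_self (by linarith)]
    linarith
  · push_cast at *
    nlinarith [logb_three_gt, Real.log_three_gt_d9]

end Bounds

/-! ### Elementary abelian 2-groups -/

section ElementaryAbelian

/-- The points `0, e₁, …, e_r`: an affine map may be prescribed freely on all of them, an
endomorphism on all but the first. -/
def affineFrame (r : ℕ) : Option (Fin r) → Multiplicative (Fin r → ZMod 2)
  | none => 1
  | some i => Multiplicative.ofAdd (Pi.single i 1)

theorem affineFrame_injective (r : ℕ) : Function.Injective (affineFrame r) := by
  have h1 : ∀ i : Fin r, (Pi.single i 1 : Fin r → ZMod 2) ≠ 0 := fun i h => by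
    simpa using congrFun h i
  rintro (_ | i) (_ | j) h
  · rfl
  · exact absurd h.symm (h1 j)
  · exact absurd h (h1 i)
  · have := congrFun (Multiplicative.ofAdd.injective h) i
    by_cases hij : i = j
    · rw [hij]
    · simp [hij] at this

theorem exists_hom_apply_affineFrame (r : ℕ) (c : Fin r → Multiplicative (Fin r → ZMod 2)) :
    ∃ φ : Multiplicative (Fin r → ZMod 2) →* Multiplicative (Fin r → ZMod 2),
      ∀ i, φ (affineFrame r (some i)) = c i := by
  refine ⟨AddMonoidHom.toMultiplicative
    (Fintype.linearCombination (ZMod 2) fun i => (c i).toAdd).toAddMonoidHom, fun i => ?_⟩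
  apply Multiplicative.toAdd.injective
  simp [affineFrame, Fintype.linearCombination_apply_single]

theorem le_endApp_elementaryAbelian (r : ℕ) :
    r ≤ endApp (Multiplicative (Fin r → ZMod 2)) := by
  obtain ⟨g, hg⟩ := exists_app_eq_minApp (endMaps (Multiplicative (Fin r → ZMod 2)))
  obtain ⟨φ, hφ⟩ := exists_hom_apply_affineFrame r fun i => g (affineFrame r (some i))
  rw [endApp, ← hg]
  refine le_trans ?_ (ncard_le_app (F := endMaps _) ⟨φ, fun _ => rfl⟩ g)
  have hsub : Set.range (fun i => affineFrame r (some i)) ⊆ {x | φ x = g x} := by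
    rintro _ ⟨i, rfl⟩; exact hφ i
  have hinj := (affineFrame_injective r).comp (Option.some_injective (Fin r))
  have hc : (Set.range (fun i => affineFrame r (some i))).ncard = r := by
    rw [← Nat.card_coe_set_eq]
    exact (Nat.card_range_of_injective hinj).trans (by simp)
  exact hc.symm.le.trans (Set.ncard_le_ncard hsub (Set.toFinite _))

theorem succ_le_affApp_elementaryAbelian (r : ℕ) :
    r + 1 ≤ affApp (Multiplicative (Fin r → ZMod 2)) := by
  obtain ⟨g, hg⟩ := exists_app_eq_minApp (affMaps (Multiplicative (Fin r → ZMod 2)))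
  obtain ⟨φ, hφ⟩ := exists_hom_apply_affineFrame r fun i => (g 1)⁻¹ * g (affineFrame r (some i))
  rw [affApp, ← hg]
  refine le_trans ?_ (ncard_le_app (F := affMaps _) (f := fun x => g 1 * φ x)
    ⟨g 1, φ, fun _ => rfl⟩ g)
  have hsub : Set.range (affineFrame r) ⊆ {x | g 1 * φ x = g x} := by
    rintro _ ⟨_ | i, rfl⟩
    · simp [affineFrame]
    · simp [hφ i]
  have hc : (Set.range (affineFrame r)).ncard = r + 1 := by
    rw [← Nat.card_coe_set_eq]
    exact (Nat.card_range_of_injective (affineFrame_injective r)).trans (by simp)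
  exact hc.symm.le.trans (Set.ncard_le_ncard hsub (Set.toFinite _))

end ElementaryAbelian

/-! ### Passage to the category of finite groups -/

section Transport

theorem minApp_congr {M N : Type*} (e : M ≃ N) {F : Set (M → M)} {F' : Set (N → N)}
    (h : ∀ A, A ∈ F ↔ e.arrowCongr e A ∈ F') : minApp F = minApp F' := by
  have happ : ∀ g, app F' (e.arrowCongr e g) = app F g := by
    intro g
    have hF : F' = e.arrowCongr e '' F := by
      ext A
      rw [Equiv.image_eq_preimage_symm, Set.mem_preimage, h, Equiv.apply_symm_apply]
    rw [app, hF, Set.image_image, app]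
    congr 1
    refine Set.image_congr fun f _ => ?_
    have : {x | e.arrowCongr e f x = e.arrowCongr e g x} = e '' {x | f x = g x} := by
      ext x
      simp [Equiv.image_eq_preimage_symm]
    rw [this, Set.ncard_image_of_injective _ e.injective]
  have : (fun g => app F g) = (fun g => app F' g) ∘ e.arrowCongr e :=
    funext fun g => (happ g).symm
  rw [minApp, minApp, this, (e.arrowCongr e).surjective.range_comp]

variable {G H : Type*} [Group G] [Group H]

theorem endApp_congr (e : G ≃* H) : endApp G = endApp H := by
  refine minApp_congr e.toEquiv fun A => ⟨?_, ?_⟩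
  · rintro ⟨φ, h⟩
    exact ⟨(e.toMonoidHom.comp φ).comp e.symm.toMonoidHom, fun x => by simp [h]⟩
  · rintro ⟨φ, h⟩
    refine ⟨(e.symm.toMonoidHom.comp φ).comp e.toMonoidHom, fun x => e.injective ?_⟩
    simpa using h (e x)

theorem affApp_congr (e : G ≃* H) : affApp G = affApp H := by
  refine minApp_congr e.toEquiv fun A => ⟨?_, ?_⟩
  · rintro ⟨g, φ, h⟩
    exact ⟨e g, (e.toMonoidHom.comp φ).comp e.symm.toMonoidHom, fun x => by simp [h]⟩
  · rintro ⟨g, φ, h⟩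
    refine ⟨e.symm g, (e.symm.toMonoidHom.comp φ).comp e.toMonoidHom, fun x => e.injective ?_⟩
    simpa using h (e x)

/-- A property of the two approximabilities holds frequently as `|G| → ∞`, in every universe, if
there are arbitrarily large finite groups in `Type` that satisfy it. -/
theorem frequently_orderAtTop {P : ℕ → ℕ → Prop}
    (h : ∀ N : ℕ, ∃ (G : Type) (_ : Group G) (_ : Finite G),
      N ≤ Nat.card G ∧ P (endApp G) (affApp G)) :
    ∃ᶠ G : FiniteGrp.{u} in orderAtTop, P (endApp G) (affApp G) := by
  rw [Filter.frequently_iff]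
  intro U hU
  obtain ⟨V, hV, hVU⟩ := Filter.mem_comap.1 hU
  obtain ⟨N, hN⟩ := Filter.mem_atTop_sets.1 hV
  obtain ⟨G, _, _, hG, hP⟩ := h N
  refine ⟨FiniteGrp.of (ULift.{u} G), hVU (hN _ ?_), ?_⟩
  · change N ≤ Nat.card (ULift.{u} G)
    simpa using hG
  · change P (endApp (ULift.{u} G)) (affApp (ULift.{u} G))
    rwa [endApp_congr MulEquiv.ulift, affApp_congr MulEquiv.ulift]

theorem affApp_isLittleO_card :
    (fun G : FiniteGrp.{u} => (affApp G : ℝ)) =o[orderAtTop]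
      (fun G : FiniteGrp.{u} => (Nat.card G : ℝ)) := by
  have hcard : Tendsto (fun G : FiniteGrp.{u} => (Nat.card G : ℝ)) orderAtTop atTop :=
    tendsto_natCast_atTop_atTop.comp tendsto_comap
  have hlog1 : Real.log =o[atTop] (id : ℝ → ℝ) := Real.isLittleO_log_id_atTop
  have hlog2 : (fun x : ℝ => Real.log x ^ 2) =o[atTop] (id : ℝ → ℝ) :=
    Real.isLittleO_pow_log_id_atTop
  have hmain : (fun x : ℝ => 1 / Real.log 2 * Real.log x ^ 2 + 2 * Real.log x)
      =o[atTop] (id : ℝ → ℝ) :=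
    (hlog2.const_mul_left _).add (hlog1.const_mul_left _)
  refine IsBigO.trans_isLittleO ?_ (hmain.comp_tendsto hcard)
  refine IsBigO.of_bound 1 ?_
  have hev : ∀ᶠ G : FiniteGrp.{u} in orderAtTop, 2 ≤ Nat.card G :=
    tendsto_comap.eventually (eventually_ge_atTop 2)
  filter_upwards [hev] with G hG
  have : Nontrivial G := Finite.one_lt_card_iff_nontrivial.1 hG
  have hlog : 0 < Real.log (Nat.card G) := Real.log_pos (by exact_mod_cast hG)
  have h := affApp_le_log G
  rw [one_mul, Real.norm_of_nonneg (Nat.cast_nonneg _)]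
  refine le_trans (h.trans_eq ?_) (le_abs_self _)
  simp only [Function.comp]
  field_simp

end Transport

/-! ### Groups on a `ℤ/p²`-module with a twisted addition -/

section Twisted

theorem natCast_mul_self_zmod_sq (p : ℕ) : (p : ZMod (p ^ 2)) * p = 0 := by
  rw [← Nat.cast_mul, ← pow_two, ZMod.natCast_self]

/-- The underlying set of the `ZMod (p ^ 2)`-module `V`, to be equipped with the multiplication
`v * w = v + w + p • B v w` for a bilinear map `B : V × V → V`. Since `p ^ 2 = 0`, this is a group
of nilpotency class at most two. -/
@[ext]
structure TwistedAddition {p : ℕ} {V : Type*} [AddCommGroup V] [Module (ZMod (p ^ 2)) V]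
    (B : V →ₗ[ZMod (p ^ 2)] V →ₗ[ZMod (p ^ 2)] V) where
  /-- The underlying vector. -/
  vec : V

namespace TwistedAddition

variable {p : ℕ} {V : Type*} [AddCommGroup V] [Module (ZMod (p ^ 2)) V]
  {B : V →ₗ[ZMod (p ^ 2)] V →ₗ[ZMod (p ^ 2)] V}

theorem smul_smul_self (v : V) : (p : ZMod (p ^ 2)) • (p : ZMod (p ^ 2)) • v = 0 := by
  rw [smul_smul, natCast_mul_self_zmod_sq, zero_smul]

instance : Mul (TwistedAddition B) :=
  ⟨fun v w => ⟨v.vec + w.vec + (p : ZMod (p ^ 2)) • B v.vec w.vec⟩⟩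

instance : One (TwistedAddition B) := ⟨⟨0⟩⟩

instance : Inv (TwistedAddition B) := ⟨fun v => ⟨-v.vec + (p : ZMod (p ^ 2)) • B v.vec v.vec⟩⟩

theorem vec_mul (v w : TwistedAddition B) :
    (v * w).vec = v.vec + w.vec + (p : ZMod (p ^ 2)) • B v.vec w.vec := rfl

theorem vec_one : (1 : TwistedAddition B).vec = 0 := rfl

theorem vec_inv (v : TwistedAddition B) :
    (v⁻¹).vec = -v.vec + (p : ZMod (p ^ 2)) • B v.vec v.vec := rfl

instance : Group (TwistedAddition B) :=
  Group.ofLeftAxioms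
    (fun u v w => by
      ext
      simp only [vec_mul, map_add, map_smul, LinearMap.add_apply, LinearMap.smul_apply, smul_add,
        smul_smul_self]
      abel)
    (fun v => by ext; simp [vec_mul, vec_one])
    (fun v => by ext; simp [vec_mul, vec_one, vec_inv, smul_smul_self])

/-- Only the antisymmetrization of `B` enters the commutators, which are central. -/
theorem vec_commutator (v w : TwistedAddition B) :
    ⁅v, w⁆.vec = (p : ZMod (p ^ 2)) • (B v.vec w.vec - B w.vec v.vec) := by
  have h : ⁅v, w⁆ = ⟨(p : ZMod (p ^ 2)) • (B v.vec w.vec - B w.vec v.vec)⟩ := by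
    rw [commutatorElement_def, mul_inv_eq_iff_eq_mul, mul_inv_eq_iff_eq_mul]
    ext
    simp only [vec_mul, map_add, map_sub, map_smul, LinearMap.add_apply, LinearMap.sub_apply,
      LinearMap.smul_apply, smul_add, smul_sub, smul_smul_self]
    abel
  rw [h]

theorem vec_pow (v : TwistedAddition B) (n : ℕ) :
    (v ^ n).vec = n • v.vec + n.choose 2 • (p : ZMod (p ^ 2)) • B v.vec v.vec := by
  induction n with
  | zero => simp [vec_one]
  | succ n ih =>
    rw [pow_succ, vec_mul, ih, Nat.choose_succ_succ' n 1, Nat.choose_one_right]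
    simp only [map_add, map_nsmul, map_smul, LinearMap.add_apply, LinearMap.smul_apply, smul_add,
      smul_comm (p : ZMod (p ^ 2)) (_ : ℕ), smul_smul_self, add_smul, one_smul, smul_zero]
    abel

/-- As `p` divides `p.choose 2` for odd `p`, the `p`-th power map is multiplication by `p`. -/
theorem vec_pow_prime (hp : p.Prime) (h2 : p ≠ 2) (v : TwistedAddition B) :
    (v ^ p).vec = (p : ZMod (p ^ 2)) • v.vec := by
  obtain ⟨c, hc⟩ := hp.dvd_choose_self two_ne_zero (lt_of_le_of_ne hp.two_le h2.symm)
  have h : p.choose 2 • (p : ZMod (p ^ 2)) • B v.vec v.vec = 0 := by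
    rw [hc, mul_comm, mul_smul, ← Nat.cast_smul_eq_nsmul (ZMod (p ^ 2)) p, smul_smul_self,
      smul_zero]
  rw [vec_pow, h, add_zero, Nat.cast_smul_eq_nsmul]

theorem commutator_commutator (u v w : TwistedAddition B) : ⁅⁅u, v⁆, w⁆ = 1 := by
  ext
  rw [vec_commutator, vec_commutator, map_smul, LinearMap.smul_apply, map_smul, ← smul_sub,
    smul_smul_self, vec_one]

end TwistedAddition

end Twisted

/-! ### The structure constants of the Jonah–Konvisser groups -/

section Form

variable {R : Type*} [CommRing R]

/-- The bilinear form, in coordinates with respect to `a₁, a₂, b₁, b₂`, that describes the product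
of the Jonah–Konvisser group. Its antisymmetrization sends `(x, y)` to the vector `z` with
`⁅x, y⁆ = z ^ p`; this makes sense because for `λ₂ = 1` the `p`-th power map induces
a bijection from the central quotient to the commutator subgroup. -/
def jkForm (R : Type*) [CommRing R] (l : ℕ) :
    (R × R × R × R) →ₗ[R] (R × R × R × R) →ₗ[R] (R × R × R × R) :=
  LinearMap.mk₂ R
    (fun v w => (v.1 * w.2.2.1 - l * (v.1 * w.2.2.2), v.1 * w.2.2.2, v.2.1 * w.2.2.1,
      v.2.1 * w.2.2.2 - v.2.1 * w.2.2.1))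
    (fun v v' w => by ext <;> simp <;> ring)
    (fun c v w => by ext <;> simp <;> ring)
    (fun v w w' => by ext <;> simp <;> ring)
    (fun c v w => by ext <;> simp <;> ring)

theorem jkForm_apply (l : ℕ) (v w : R × R × R × R) :
    jkForm R l v w = (v.1 * w.2.2.1 - l * (v.1 * w.2.2.2), v.1 * w.2.2.2, v.2.1 * w.2.2.1,
      v.2.1 * w.2.2.2 - v.2.1 * w.2.2.1) := rfl

/-- The antisymmetrization of `jkForm`. -/
def jkBracket (R : Type*) [CommRing R] (l : ℕ) :
    (R × R × R × R) →ₗ[R] (R × R × R × R) →ₗ[R] (R × R × R × R) :=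
  jkForm R l - (jkForm R l).flip

theorem jkBracket_apply (l : ℕ) (v w : R × R × R × R) :
    jkBracket R l v w = jkForm R l v w - jkForm R l w v := rfl

theorem jkBracket_self (l : ℕ) (v : R × R × R × R) : jkBracket R l v v = 0 := sub_self _

end Form

/-! ### The linear algebra of endomorphisms -/

section LinearAlgebra

variable {K : Type*} [Field K]

/-- If `v = (x, y)` and `w = (x', y')` in `K² × K²` satisfy `x ⊗ y' = x' ⊗ y`, then both lie in
`0 × K²`, or both in `K² × 0`, or they are proportional. -/
theorem zero_or_proportional_of_tensor_eq {v w : K × K × K × K}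
    (h₁ : v.1 * w.2.2.1 = w.1 * v.2.2.1) (h₂ : v.1 * w.2.2.2 = w.1 * v.2.2.2)
    (h₃ : v.2.1 * w.2.2.1 = w.2.1 * v.2.2.1) (h₄ : v.2.1 * w.2.2.2 = w.2.1 * v.2.2.2) :
    (v.1 = 0 ∧ v.2.1 = 0 ∧ w.1 = 0 ∧ w.2.1 = 0) ∨
    (v.2.2.1 = 0 ∧ v.2.2.2 = 0 ∧ w.2.2.1 = 0 ∧ w.2.2.2 = 0) ∨
    v = 0 ∨ ∃ c : K, w = c • v := by
  obtain ⟨x, x', y, y'⟩ := v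
  obtain ⟨s, s', t, t'⟩ := w
  simp only [Prod.mk_eq_zero, Prod.smul_mk, smul_eq_mul, Prod.mk.injEq] at *
  by_cases hy : y = 0 ∧ y' = 0
  · grind
  by_cases hx : x = 0 ∧ x' = 0
  · left
    grind
  right; right; right
  have hc : ∃ c : K, s = c * x ∧ s' = c * x' := by
    by_cases hy0 : y = 0
    · have : y' ≠ 0 := fun h => hy ⟨hy0, h⟩
      exact ⟨t' / y', by field_simp; grind, by field_simp; grind⟩
    · exact ⟨t / y, by field_simp; grind, by field_simp; grind⟩
  obtain ⟨c, rfl, rfl⟩ := hc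
  refine ⟨c, rfl, rfl, ?_⟩
  by_cases hx0 : x = 0
  · have hx' : x' ≠ 0 := fun h => hx ⟨hx0, h⟩
    exact ⟨mul_left_cancel₀ hx' (by linear_combination h₃),
      mul_left_cancel₀ hx' (by linear_combination h₄)⟩
  · exact ⟨mul_left_cancel₀ hx0 (by linear_combination h₁),
      mul_left_cancel₀ hx0 (by linear_combination h₂)⟩

/-- The defining relations of the Jonah–Konvisser group for vectors `v₁, v₂, v₃, v₄` in the central
quotient `V`, where the commutator map, followed by the inverse of the `p`-th power map, becomes
a bilinear map `D` and taking `p`-th powers becomes the identity. -/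
structure JKRelations {V : Type*} [AddCommGroup V] [Module K V] (D : V →ₗ[K] V →ₗ[K] V) (l : ℕ)
    (v₁ v₂ v₃ v₄ : V) : Prop where
  pow_a₁ : v₁ = D v₁ v₃
  pow_a₂ : v₂ = D v₁ ((l : K) • v₃ + v₄)
  pow_b₁ : v₃ = D v₂ (v₃ + v₄)
  pow_b₂ : v₄ = D v₂ v₄
  comm_a : D v₁ v₂ = 0
  comm_b : D v₃ v₄ = 0

namespace JKRelations

variable {V : Type*} [AddCommGroup V] [Module K V] {D : V →ₗ[K] V →ₗ[K] V} {l : ℕ}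
  {v₁ v₂ v₃ v₄ : V}

theorem eq_zero_of_a₂_eq_zero (h : JKRelations D l v₁ v₂ v₃ v₄) (h₂ : v₂ = 0) :
    v₁ = 0 ∧ v₂ = 0 ∧ v₃ = 0 ∧ v₄ = 0 := by
  have h₃ := h.pow_b₁
  have h₄ := h.pow_b₂
  have h₁ := h.pow_a₁
  simp only [h₂, map_zero, LinearMap.zero_apply] at h₃ h₄
  rw [h₃, map_zero] at h₁
  exact ⟨h₁, h₂, h₃, h₄⟩

theorem eq_zero_of_a₁_eq_zero (h : JKRelations D l v₁ v₂ v₃ v₄) (h₁ : v₁ = 0) :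
    v₁ = 0 ∧ v₂ = 0 ∧ v₃ = 0 ∧ v₄ = 0 :=
  h.eq_zero_of_a₂_eq_zero (by simpa [h₁] using h.pow_a₂)

/-- There is no solution in which `v₁` and `v₂` are proportional, except zero. -/
theorem eq_zero_of_a₂_eq_smul (h : JKRelations D l v₁ v₂ v₃ v₄) (hD : ∀ v, D v v = 0) {c : K}
    (hc : v₂ = c • v₁) : v₁ = 0 ∧ v₂ = 0 ∧ v₃ = 0 ∧ v₄ = 0 := by
  refine h.eq_zero_of_a₁_eq_zero ?_
  have h₁ := h.pow_a₁
  have h₂ := h.pow_a₂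
  have h₃ := h.pow_b₁
  have h₄ := h.pow_b₂
  rw [hc, map_add, map_smul, ← h₁] at h₂
  have h14 : D v₁ v₄ = (c - l) • v₁ := by rw [sub_smul, h₂]; abel
  rw [hc, map_smul, LinearMap.smul_apply, h14] at h₄
  have hz : D v₁ v₄ = 0 := by rw [h₄, map_smul, map_smul, hD]; simp
  rw [hc, map_smul, LinearMap.smul_apply, map_add, ← h₁, hz, add_zero] at h₃
  rw [h₃, map_smul, hD, smul_zero] at h₁
  exact h₁

theorem eq_zero_of_b₁_eq_zero (h : JKRelations D l v₁ v₂ v₃ v₄) (h₃ : v₃ = 0) :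
    v₁ = 0 ∧ v₂ = 0 ∧ v₃ = 0 ∧ v₄ = 0 :=
  h.eq_zero_of_a₁_eq_zero (by simpa [h₃] using h.pow_a₁)

/-- There is no solution in which `v₃` and `v₄` are proportional, except zero. -/
theorem eq_zero_of_b₂_eq_smul (h : JKRelations D l v₁ v₂ v₃ v₄) (hD : ∀ v, D v v = 0) {c : K}
    (hc : v₄ = c • v₃) : v₁ = 0 ∧ v₂ = 0 ∧ v₃ = 0 ∧ v₄ = 0 := by
  by_cases hc0 : c = 0
  · refine h.eq_zero_of_a₂_eq_smul hD (c := l) ?_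
    have h₂ := h.pow_a₂
    rwa [hc, hc0, zero_smul, add_zero, map_smul, ← h.pow_a₁] at h₂
  · refine h.eq_zero_of_b₁_eq_zero ?_
    have h₃ := h.pow_b₁
    have h₄ := h.pow_b₂
    rw [hc, map_smul] at h₄
    have h23 : v₃ = D v₂ v₃ := smul_right_injective V hc0 h₄
    rw [hc, map_add, map_smul, ← h23] at h₃
    have : c • v₃ = 0 := by simpa using h₃.symm
    exact (smul_eq_zero.1 this).resolve_left hc0

/-- The only solutions of the relations in the central quotient are zero and the standard basis.
Write `A`, `B` for the spans of the first and the last two basis vectors. The relations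
`D v₁ v₂ = 0` and `D v₃ v₄ = 0` force each of the pairs `(v₁, v₂)` and `(v₃, v₄)` to lie in `A` or
in `B`, or to be linearly dependent; dependence leads to the zero solution. -/
theorem eq_zero_or_eq_basis {v₁ v₂ v₃ v₄ : K × K × K × K}
    (h : JKRelations (jkBracket K l) l v₁ v₂ v₃ v₄) :
    (v₁ = 0 ∧ v₂ = 0 ∧ v₃ = 0 ∧ v₄ = 0) ∨
    (v₁ = (1, 0, 0, 0) ∧ v₂ = (0, 1, 0, 0) ∧ v₃ = (0, 0, 1, 0) ∧ v₄ = (0, 0, 0, 1)) := by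
  have hD := jkBracket_self (R := K) l
  by_contra hcon
  have hn : ¬ (v₁ = 0 ∧ v₂ = 0 ∧ v₃ = 0 ∧ v₄ = 0) := fun h => hcon (Or.inl h)
  have hA := h.comm_a
  have hB := h.comm_b
  have tens : ∀ {v w : K × K × K × K}, jkBracket K l v w = 0 →
      v.1 * w.2.2.1 = w.1 * v.2.2.1 ∧ v.1 * w.2.2.2 = w.1 * v.2.2.2 ∧
      v.2.1 * w.2.2.1 = w.2.1 * v.2.2.1 ∧ v.2.1 * w.2.2.2 = w.2.1 * v.2.2.2 := by
    intro v w hvw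
    simp only [jkBracket_apply, jkForm_apply, Prod.mk_sub_mk, Prod.mk_eq_zero] at hvw
    obtain ⟨e₁, e₂, e₃, e₄⟩ := hvw
    exact ⟨by linear_combination e₁ + l * e₂, by linear_combination e₂,
      by linear_combination e₃, by linear_combination e₄ + e₃⟩
  obtain ⟨e₁, e₂, e₃, e₄⟩ := tens hA
  obtain ⟨f₁, f₂, f₃, f₄⟩ := tens hB
  have hAcase := zero_or_proportional_of_tensor_eq e₁ e₂ e₃ e₄
  have hBcase := zero_or_proportional_of_tensor_eq f₁ f₂ f₃ f₄
  rw [← or_assoc] at hAcase hBcase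
  replace hAcase := hAcase.resolve_right (by
    rintro (h0 | ⟨c, hc⟩)
    · exact hn (h.eq_zero_of_a₁_eq_zero h0)
    · exact hn (h.eq_zero_of_a₂_eq_smul hD hc))
  replace hBcase := hBcase.resolve_right (by
    rintro (h0 | ⟨c, hc⟩)
    · exact hn (h.eq_zero_of_b₁_eq_zero h0)
    · exact hn (h.eq_zero_of_b₂_eq_smul hD hc))
  have n₁ : v₁ ≠ 0 := fun h0 => hn (h.eq_zero_of_a₁_eq_zero h0)
  have n₂ : v₂ ≠ 0 := fun h0 => hn (h.eq_zero_of_a₂_eq_zero h0)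
  have n₃ : v₃ ≠ 0 := fun h0 => hn (h.eq_zero_of_b₁_eq_zero h0)
  have p₁ := h.pow_a₁
  have p₂ := h.pow_a₂
  have p₃ := h.pow_b₁
  have p₄ := h.pow_b₂
  clear hA hB e₁ e₂ e₃ e₄ f₁ f₂ f₃ f₄ tens hD hn h
  obtain ⟨a, a', b, b'⟩ := v₁
  obtain ⟨c, c', d, d'⟩ := v₂
  obtain ⟨s, s', t, t'⟩ := v₃
  obtain ⟨x, x', y, y'⟩ := v₄
  simp only [jkBracket_apply, jkForm_apply, Prod.mk_sub_mk, Prod.smul_mk, Prod.mk_add_mk,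
    smul_eq_mul, Prod.mk_eq_zero, Prod.mk.injEq, ne_eq] at *
  -- `D` vanishes on `A × A` and on `B × B`; if the endomorphism exchanged `A` and `B`, it would be
  -- zero; if it preserves both, comparing coordinates leaves the identity only
  rcases hAcase with ⟨rfl, rfl, rfl, rfl⟩ | ⟨rfl, rfl, rfl, rfl⟩ <;>
    rcases hBcase with ⟨rfl, rfl, rfl, rfl⟩ | ⟨rfl, rfl, rfl, rfl⟩
  · simp at p₁ n₁; grind
  · simp at p₁ p₂ p₃ p₄ n₁ n₂ n₃
    grind
  · simp at p₁ p₂ p₃ p₄ n₁ n₂ n₃ hcon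
    by_cases hy : y = 0 <;> grind
  · simp at p₁ n₁; grind

end JKRelations

end LinearAlgebra

/-! ### Normal form in the Jonah–Konvisser groups -/

section ClassTwo

variable {G : Type*} [Group G]

theorem commutator_mul_right_of_central (hc : ∀ x y z : G, ⁅⁅x, y⁆, z⁆ = 1) (x y z : G) :
    ⁅x, y * z⁆ = ⁅x, y⁆ * ⁅x, z⁆ := by
  have h := commutatorElement_eq_one_iff_mul_comm.1 (hc x z y)
  rw [commutatorElement_mul_right_eq_mul_conj, mul_assoc ⁅x, y⁆, ← h]
  group

theorem commutator_pow_right_of_central (hc : ∀ x y z : G, ⁅⁅x, y⁆, z⁆ = 1) (x y : G) (n : ℕ) :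
    ⁅x, y ^ n⁆ = ⁅x, y⁆ ^ n := by
  induction n with
  | zero => simp
  | succ n ih => rw [pow_succ, commutator_mul_right_of_central hc, ih, pow_succ]

theorem conj_zpow_of_central (hc : ∀ x y z : G, ⁅⁅x, y⁆, z⁆ = 1) (x y : G) (i : ℤ) :
    y * x ^ i * y⁻¹ = ⁅x, y⁆ ^ (-i) * x ^ i := by
  have hxy : y * x * y⁻¹ = ⁅x, y⁆⁻¹ * x := by rw [commutatorElement_def]; group
  have hcomm : Commute ⁅x, y⁆ x := commutatorElement_eq_one_iff_commute.1 (hc x y x)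
  rw [← conj_zpow, hxy, hcomm.inv_left.mul_zpow, inv_zpow, zpow_neg]

theorem zpow_mul_zpow_of_central (hc : ∀ x y z : G, ⁅⁅x, y⁆, z⁆ = 1) (x y : G) (n i : ℤ) :
    y ^ n * x ^ i = ⁅x, y⁆ ^ (-(n * i)) * (x ^ i * y ^ n) := by
  have hyx : ∀ k : ℤ, x * y ^ k * x⁻¹ = ⁅x, y⁆ ^ k * y ^ k := by
    intro k
    rw [conj_zpow_of_central hc, ← commutatorElement_inv x y, inv_zpow, zpow_neg, inv_inv]
  have hn : ⁅x, y ^ n⁆ = ⁅x, y⁆ ^ n := by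
    rw [commutatorElement_def, hyx]; group
  have h := conj_zpow_of_central hc x (y ^ n) i
  rw [hn, ← zpow_mul, mul_neg, mul_inv_eq_iff_eq_mul] at h
  rw [h, mul_assoc]

/-- If `x ^ n` is central, conjugating it by `y` shows `⁅x, y⁆ ^ n = 1`. -/
theorem commutator_pow_eq_one (hc : ∀ x y z : G, ⁅⁅x, y⁆, z⁆ = 1) {x : G} {n : ℕ}
    (hx : ∀ y, Commute (x ^ n) y) (y : G) : ⁅x, y⁆ ^ n = 1 := by
  have h := conj_zpow_of_central hc x y n
  rw [zpow_neg, zpow_natCast, zpow_natCast, ← (hx y).eq, mul_inv_cancel_right] at h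
  exact inv_eq_one.1 (mul_eq_right.1 h.symm)

end ClassTwo

section Presentation

/-- The elements `a₁, a₂, b₁, b₂` satisfy the defining relations of the Jonah–Konvisser group with
`λ₁ = l` and `λ₂ = 1`, inside a group of nilpotency class at most two. -/
structure IsJKSystem {G : Type*} [Group G] (p l : ℕ) (a₁ a₂ b₁ b₂ : G) : Prop where
  central : ∀ x y z : G, ⁅⁅x, y⁆, z⁆ = 1
  pow_a₁ : a₁ ^ p = ⁅a₁, b₁⁆
  pow_a₂ : a₂ ^ p = ⁅a₁, b₁ ^ l * b₂⁆
  pow_b₁ : b₁ ^ p = ⁅a₂, b₁ * b₂⁆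
  pow_b₂ : b₂ ^ p = ⁅a₂, b₂⁆
  comm_a : ⁅a₁, a₂⁆ = 1
  comm_b : ⁅b₁, b₂⁆ = 1

namespace IsJKSystem

variable {G : Type*} [Group G] {p l : ℕ} {a₁ a₂ b₁ b₂ : G}

theorem commute_commutator (h : IsJKSystem p l a₁ a₂ b₁ b₂) (x y z : G) : Commute ⁅x, y⁆ z :=
  commutatorElement_eq_one_iff_commute.1 (h.central x y z)

/-- The `p`-th powers of the generators are commutators with `a₁` or `a₂`, and the `p`-th
powers of such commutators vanish because `a₁ ^ p` and `a₂ ^ p` are central. -/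
theorem pow_sq_eq_one (h : IsJKSystem p l a₁ a₂ b₁ b₂) :
    a₁ ^ p ^ 2 = 1 ∧ a₂ ^ p ^ 2 = 1 ∧ b₁ ^ p ^ 2 = 1 ∧ b₂ ^ p ^ 2 = 1 := by
  have h₁ := commutator_pow_eq_one h.central (x := a₁) (n := p)
    (fun y => h.pow_a₁ ▸ h.commute_commutator _ _ y)
  have h₂ := commutator_pow_eq_one h.central (x := a₂) (n := p)
    (fun y => h.pow_a₂ ▸ h.commute_commutator _ _ y)
  simp only [pow_two, pow_mul]
  rw [h.pow_a₁, h.pow_a₂, h.pow_b₁, h.pow_b₂]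
  exact ⟨h₁ _, h₁ _, h₂ _, h₂ _⟩

theorem zpow_b₁_mul (h : IsJKSystem p l a₁ a₂ b₁ b₂) (n i j k m : ℤ) :
    b₁ ^ n * (a₁ ^ i * a₂ ^ j * b₁ ^ k * b₂ ^ m) =
      a₁ ^ (i - p * (n * i)) * a₂ ^ j * b₁ ^ (k + n - p * (n * j)) * b₂ ^ (m + p * (n * j)) := by
  have hb : Commute b₁ b₂ := commutatorElement_eq_one_iff_commute.1 h.comm_b
  have h₁ : b₁ ^ n * a₁ ^ i = a₁ ^ (i - p * (n * i)) * b₁ ^ n := by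
    rw [zpow_mul_zpow_of_central h.central, ← h.pow_a₁, ← zpow_natCast, ← zpow_mul, ← mul_assoc,
      ← zpow_add]
    congr 2; ring
  have h21 : ⁅a₂, b₁⁆ = b₁ ^ p * (b₂ ^ p)⁻¹ := by
    rw [h.pow_b₁, h.pow_b₂, commutator_mul_right_of_central h.central, mul_inv_cancel_right]
  have hcen : Commute (⁅a₂, b₁⁆ ^ (-(n * j))) (a₂ ^ j) :=
    (h.commute_commutator _ _ _).zpow_left _
  have h₂ : b₁ ^ n * a₂ ^ j = a₂ ^ j * (b₁ ^ (n - p * (n * j)) * b₂ ^ (p * (n * j))) := by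
    rw [zpow_mul_zpow_of_central h.central, ← mul_assoc, hcen.eq, mul_assoc, h21,
      ((hb.pow_pow p p).inv_right).mul_zpow, ← zpow_natCast, ← zpow_natCast, ← zpow_mul, inv_zpow,
      ← zpow_mul, mul_assoc, ← zpow_neg, ((hb.symm).zpow_zpow _ n).eq, ← mul_assoc (b₁ ^ _),
      ← zpow_add]
    congr 3 <;> ring
  calc b₁ ^ n * (a₁ ^ i * a₂ ^ j * b₁ ^ k * b₂ ^ m)
      = (b₁ ^ n * a₁ ^ i) * a₂ ^ j * b₁ ^ k * b₂ ^ m := by simp only [mul_assoc]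
    _ = a₁ ^ (i - p * (n * i)) * (b₁ ^ n * a₂ ^ j) * b₁ ^ k * b₂ ^ m := by
        rw [h₁]; simp only [mul_assoc]
    _ = a₁ ^ (i - p * (n * i)) * a₂ ^ j * b₁ ^ (n - p * (n * j)) * (b₂ ^ (p * (n * j)) * b₁ ^ k)
          * b₂ ^ m := by rw [h₂]; simp only [mul_assoc]
    _ = a₁ ^ (i - p * (n * i)) * a₂ ^ j * (b₁ ^ (n - p * (n * j)) * b₁ ^ k)
          * (b₂ ^ (p * (n * j)) * b₂ ^ m) := by
        rw [((hb.symm).zpow_zpow _ k).eq]; simp only [mul_assoc]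
    _ = _ := by
        rw [← zpow_add, ← zpow_add]
        congr 2
        · congr 1; ring
        · ring

theorem zpow_b₂_mul (h : IsJKSystem p l a₁ a₂ b₁ b₂) (n i j k m : ℤ) :
    b₂ ^ n * (a₁ ^ i * a₂ ^ j * b₁ ^ k * b₂ ^ m) =
      a₁ ^ (i + p * l * (n * i)) * a₂ ^ (j - p * (n * i)) * b₁ ^ k * b₂ ^ (m + n - p * (n * j)) := by
  have hb : Commute b₁ b₂ := commutatorElement_eq_one_iff_commute.1 h.comm_b
  have ha : Commute a₁ a₂ := commutatorElement_eq_one_iff_commute.1 h.comm_a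
  have h12 : ⁅a₁, b₂⁆ = (a₁ ^ (p * l))⁻¹ * a₂ ^ p := by
    rw [h.pow_a₂, pow_mul, h.pow_a₁, commutator_mul_right_of_central h.central,
      commutator_pow_right_of_central h.central, inv_mul_cancel_left]
  have hcen : Commute (⁅a₁, b₂⁆ ^ (-(n * i))) (a₁ ^ i) :=
    (h.commute_commutator _ _ _).zpow_left _
  have h₁ : b₂ ^ n * a₁ ^ i = a₁ ^ (i + p * l * (n * i)) * a₂ ^ (-(p * (n * i))) * b₂ ^ n := by
    rw [zpow_mul_zpow_of_central h.central, ← mul_assoc, hcen.eq, h12,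
      ((ha.pow_pow (p * l) p).inv_left).mul_zpow, ← zpow_natCast, ← zpow_natCast, inv_zpow,
      ← zpow_mul, ← zpow_mul, ← zpow_neg, ← mul_assoc, ← zpow_add]
    congr 3 <;> push_cast <;> ring
  have hcen' : Commute (b₂ ^ (-(p * (n * j)))) (a₂ ^ j) := by
    rw [zpow_neg, zpow_mul, zpow_natCast, h.pow_b₂]
    exact ((h.commute_commutator _ _ _).zpow_left _).inv_left
  have h₂ : b₂ ^ n * a₂ ^ j = a₂ ^ j * b₂ ^ (n - p * (n * j)) := by
    rw [zpow_mul_zpow_of_central h.central, ← h.pow_b₂, ← zpow_natCast, ← zpow_mul, mul_neg,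
      ← mul_assoc, hcen'.eq, mul_assoc, ← zpow_add]
    congr 2; ring
  calc b₂ ^ n * (a₁ ^ i * a₂ ^ j * b₁ ^ k * b₂ ^ m)
      = (b₂ ^ n * a₁ ^ i) * a₂ ^ j * b₁ ^ k * b₂ ^ m := by simp only [mul_assoc]
    _ = a₁ ^ (i + p * l * (n * i)) * a₂ ^ (-(p * (n * i))) * (b₂ ^ n * a₂ ^ j) * b₁ ^ k
          * b₂ ^ m := by rw [h₁]; simp only [mul_assoc]
    _ = a₁ ^ (i + p * l * (n * i)) * (a₂ ^ (-(p * (n * i))) * a₂ ^ j)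
          * (b₂ ^ (n - p * (n * j)) * b₁ ^ k) * b₂ ^ m := by rw [h₂]; simp only [mul_assoc]
    _ = a₁ ^ (i + p * l * (n * i)) * (a₂ ^ (-(p * (n * i))) * a₂ ^ j) * b₁ ^ k
          * (b₂ ^ (n - p * (n * j)) * b₂ ^ m) := by
        rw [((hb.symm).zpow_zpow _ k).eq]; simp only [mul_assoc]
    _ = _ := by
        rw [← zpow_add, ← zpow_add, show -(p * (n * i)) + j = j - p * (n * i) by ring,
          show n - p * (n * j) + m = m + n - p * (n * j) by ring]

/-- If the system generates, every element has the normal form `a₁ ^ i a₂ ^ j b₁ ^ k b₂ ^ m`. -/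
theorem exists_normal_form (h : IsJKSystem p l a₁ a₂ b₁ b₂)
    (htop : Subgroup.closure {a₁, a₂, b₁, b₂} = ⊤) (g : G) :
    ∃ i j k m : ℤ, g = a₁ ^ i * a₂ ^ j * b₁ ^ k * b₂ ^ m := by
  have ha : Commute a₁ a₂ := commutatorElement_eq_one_iff_commute.1 h.comm_a
  have key : ∀ x ∈ ({a₁, a₂, b₁, b₂} : Set G), ∀ (n : ℤ) (y : G),
      (∃ i j k m : ℤ, y = a₁ ^ i * a₂ ^ j * b₁ ^ k * b₂ ^ m) →
      ∃ i j k m : ℤ, x ^ n * y = a₁ ^ i * a₂ ^ j * b₁ ^ k * b₂ ^ m := by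
    rintro x hx n _ ⟨i, j, k, m, rfl⟩
    rcases hx with rfl | rfl | rfl | rfl
    · exact ⟨n + i, j, k, m, by rw [zpow_add]; simp only [mul_assoc]⟩
    · refine ⟨i, n + j, k, m, ?_⟩
      rw [zpow_add, ← mul_assoc, ← mul_assoc, ← mul_assoc, ← (ha.zpow_zpow i n).eq]
      simp only [mul_assoc]
    · exact ⟨_, _, _, _, h.zpow_b₁_mul n i j k m⟩
    · exact ⟨_, _, _, _, h.zpow_b₂_mul n i j k m⟩
  have hg : g ∈ Subgroup.closure {a₁, a₂, b₁, b₂} := htop ▸ Subgroup.mem_top g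
  induction hg using Subgroup.closure_induction_left with
  | one => exact ⟨0, 0, 0, 0, by simp⟩
  | mul_left x hx y _ ih => simpa using key x hx 1 y ih
  | inv_mul_cancel x hx y _ ih => simpa using key x hx (-1) y ih

/-- The normal form makes the group an image of the set of exponents modulo `p ^ 2`. -/
theorem finite_and_card_le [NeZero p] (h : IsJKSystem p l a₁ a₂ b₁ b₂)
    (htop : Subgroup.closure {a₁, a₂, b₁, b₂} = ⊤) : Finite G ∧ Nat.card G ≤ p ^ 8 := by
  let R := ZMod (p ^ 2)
  let σ : R × R × R × R → G := fun v =>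
    a₁ ^ (v.1.val : ℤ) * a₂ ^ (v.2.1.val : ℤ) * b₁ ^ (v.2.2.1.val : ℤ) * b₂ ^ (v.2.2.2.val : ℤ)
  have hσ : Function.Surjective σ := by
    intro g
    obtain ⟨i, j, k, m, rfl⟩ := h.exists_normal_form htop g
    obtain ⟨h₁, h₂, h₃, h₄⟩ := h.pow_sq_eq_one
    refine ⟨(i, j, k, m), ?_⟩
    simp only [σ, R, ZMod.val_intCast]
    rw [← zpow_eq_zpow_emod' i h₁, ← zpow_eq_zpow_emod' j h₂, ← zpow_eq_zpow_emod' k h₃,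
      ← zpow_eq_zpow_emod' m h₄]
  refine ⟨Finite.of_surjective σ hσ, (Nat.card_le_card_of_surjective σ hσ).trans_eq ?_⟩
  simp only [R, Nat.card_prod, Nat.card_zmod]
  ring

end IsJKSystem

theorem isJKSystem_presented (p l : ℕ) :
    IsJKSystem p l (PresentedGroup.of .a₁ : JKGroup p l 1) (PresentedGroup.of .a₂)
      (PresentedGroup.of .b₁) (PresentedGroup.of .b₂) := by
  have hrel : ∀ w ∈ JKGen.rels p l 1, PresentedGroup.mk (JKGen.rels p l 1) w = 1 :=
    fun w hw => PresentedGroup.one_of_mem hw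
  refine ⟨fun x y z => ?_, ?_, ?_, ?_, ?_, ?_, ?_⟩
  · obtain ⟨x, rfl⟩ := PresentedGroup.mk_surjective _ x
    obtain ⟨y, rfl⟩ := PresentedGroup.mk_surjective _ y
    obtain ⟨z, rfl⟩ := PresentedGroup.mk_surjective _ z
    simpa only [map_commutatorElement] using hrel _ (Or.inl ⟨x, y, z, rfl⟩)
  · have := hrel (FreeGroup.of JKGen.a₁ ^ p * ⁅FreeGroup.of JKGen.a₁, FreeGroup.of JKGen.b₁⁆⁻¹)
      (by simp [JKGen.rels])
    rwa [map_mul, map_inv, mul_inv_eq_one, map_pow, map_commutatorElement] at this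
  · have := hrel (FreeGroup.of JKGen.a₂ ^ p *
      ⁅FreeGroup.of JKGen.a₁, FreeGroup.of JKGen.b₁ ^ l * FreeGroup.of JKGen.b₂ ^ 1⁆⁻¹) (by simp [JKGen.rels])
    rwa [map_mul, map_inv, mul_inv_eq_one, map_pow, map_commutatorElement, pow_one, map_mul,
      map_pow] at this
  · have := hrel (FreeGroup.of JKGen.b₁ ^ p *
      ⁅FreeGroup.of JKGen.a₂, FreeGroup.of JKGen.b₁ * FreeGroup.of JKGen.b₂⁆⁻¹) (by simp [JKGen.rels])
    rwa [map_mul, map_inv, mul_inv_eq_one, map_pow, map_commutatorElement, map_mul] at this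
  · have := hrel (FreeGroup.of JKGen.b₂ ^ p * ⁅FreeGroup.of JKGen.a₂, FreeGroup.of JKGen.b₂⁆⁻¹)
      (by simp [JKGen.rels])
    rwa [map_mul, map_inv, mul_inv_eq_one, map_pow, map_commutatorElement] at this
  · have := hrel ⁅FreeGroup.of JKGen.a₁, FreeGroup.of JKGen.a₂⁆ (by simp [JKGen.rels])
    rwa [map_commutatorElement] at this
  · have := hrel ⁅FreeGroup.of JKGen.b₁, FreeGroup.of JKGen.b₂⁆ (by simp [JKGen.rels])
    rwa [map_commutatorElement] at this

theorem closure_jkGroup_generators (p l : ℕ) :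
    Subgroup.closure {(PresentedGroup.of .a₁ : JKGroup p l 1), PresentedGroup.of .a₂,
      PresentedGroup.of .b₁, PresentedGroup.of .b₂} = ⊤ := by
  rw [← PresentedGroup.closure_range_of]
  congr 1
  ext x
  constructor
  · rintro (rfl | rfl | rfl | rfl) <;> exact ⟨_, rfl⟩
  · rintro ⟨_ | _ | _ | _, rfl⟩ <;> simp

/-- A system satisfying the defining relations is the image of the generators under
a homomorphism. -/
theorem IsJKSystem.exists_hom {G : Type*} [Group G] {p l : ℕ} {a₁ a₂ b₁ b₂ : G}
    (h : IsJKSystem p l a₁ a₂ b₁ b₂) :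
    ∃ Φ : JKGroup p l 1 →* G, Φ (.of .a₁) = a₁ ∧ Φ (.of .a₂) = a₂ ∧ Φ (.of .b₁) = b₁ ∧
      Φ (.of .b₂) = b₂ := by
  let f : JKGen → G := fun | .a₁ => a₁ | .a₂ => a₂ | .b₁ => b₁ | .b₂ => b₂
  have hf : ∀ r ∈ JKGen.rels p l 1, FreeGroup.lift f r = 1 := by
    rintro r (⟨x, y, z, rfl⟩ | hr)
    · simp only [map_commutatorElement, h.central]
    · rcases hr with rfl | rfl | rfl | rfl | rfl | rfl <;>
        simp [map_commutatorElement, -commutatorElement_inv, f, h.comm_a, h.comm_b, h.pow_a₁,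
          h.pow_a₂, h.pow_b₁, h.pow_b₂]
  exact ⟨PresentedGroup.toGroup hf, PresentedGroup.toGroup.of hf, PresentedGroup.toGroup.of hf,
    PresentedGroup.toGroup.of hf, PresentedGroup.toGroup.of hf⟩

end Presentation

/-! ### A concrete model of the Jonah–Konvisser group -/

section Reduction

variable {p : ℕ}

/-- Coordinatewise reduction modulo `p` of vectors over `ZMod (p ^ 2)`. -/
def reduceModP (p : ℕ) : (ZMod (p ^ 2) × ZMod (p ^ 2) × ZMod (p ^ 2) × ZMod (p ^ 2)) →+
    (ZMod p × ZMod p × ZMod p × ZMod p) :=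
  let c := (ZMod.castHom (dvd_pow_self p two_ne_zero) (ZMod p)).toAddMonoidHom
  c.prodMap (c.prodMap (c.prodMap c))

theorem reduceModP_apply (v : ZMod (p ^ 2) × ZMod (p ^ 2) × ZMod (p ^ 2) × ZMod (p ^ 2)) :
    reduceModP p v = (ZMod.castHom (dvd_pow_self p two_ne_zero) (ZMod p) v.1,
      ZMod.castHom (dvd_pow_self p two_ne_zero) (ZMod p) v.2.1,
      ZMod.castHom (dvd_pow_self p two_ne_zero) (ZMod p) v.2.2.1,
      ZMod.castHom (dvd_pow_self p two_ne_zero) (ZMod p) v.2.2.2) := rfl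

theorem castHom_eq_zero_iff_exists [NeZero p] (x : ZMod (p ^ 2)) :
    ZMod.castHom (dvd_pow_self p two_ne_zero) (ZMod p) x = 0 ↔ ∃ y, x = p * y := by
  constructor
  · intro h
    rw [← ZMod.natCast_zmod_val x, map_natCast, ZMod.natCast_eq_zero_iff] at h
    obtain ⟨c, hc⟩ := h
    exact ⟨c, by rw [← Nat.cast_mul, ← hc, ZMod.natCast_zmod_val]⟩
  · rintro ⟨y, rfl⟩
    rw [map_mul, map_natCast, ZMod.natCast_self, zero_mul]

theorem castHom_eq_zero_iff_mul_eq_zero [NeZero p] (x : ZMod (p ^ 2)) :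
    ZMod.castHom (dvd_pow_self p two_ne_zero) (ZMod p) x = 0 ↔ (p : ZMod (p ^ 2)) * x = 0 := by
  have hp : 0 < p := Nat.pos_of_neZero p
  rw [← ZMod.natCast_zmod_val x, map_natCast, ZMod.natCast_eq_zero_iff, ← Nat.cast_mul,
    ZMod.natCast_eq_zero_iff, ← Nat.mul_dvd_mul_iff_left hp, ← pow_two]

theorem reduceModP_eq_zero_iff_exists [NeZero p]
    (v : ZMod (p ^ 2) × ZMod (p ^ 2) × ZMod (p ^ 2) × ZMod (p ^ 2)) :
    reduceModP p v = 0 ↔ ∃ u, v = (p : ZMod (p ^ 2)) • u := by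
  simp only [reduceModP_apply, Prod.mk_eq_zero, castHom_eq_zero_iff_exists]
  constructor
  · rintro ⟨⟨a, ha⟩, ⟨b, hb⟩, ⟨c, hc⟩, ⟨d, hd⟩⟩
    exact ⟨(a, b, c, d), Prod.ext ha (Prod.ext hb (Prod.ext hc hd))⟩
  · rintro ⟨u, rfl⟩
    exact ⟨⟨_, rfl⟩, ⟨_, rfl⟩, ⟨_, rfl⟩, ⟨_, rfl⟩⟩

theorem reduceModP_eq_zero_iff_smul_eq_zero [NeZero p]
    (v : ZMod (p ^ 2) × ZMod (p ^ 2) × ZMod (p ^ 2) × ZMod (p ^ 2)) :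
    reduceModP p v = 0 ↔ (p : ZMod (p ^ 2)) • v = 0 := by
  obtain ⟨a, b, c, d⟩ := v
  simp only [reduceModP_apply, Prod.mk_eq_zero, castHom_eq_zero_iff_mul_eq_zero, Prod.smul_mk,
    smul_eq_mul]

theorem reduceModP_jkForm (l : ℕ)
    (v w : ZMod (p ^ 2) × ZMod (p ^ 2) × ZMod (p ^ 2) × ZMod (p ^ 2)) :
    reduceModP p (jkForm _ l v w) = jkForm _ l (reduceModP p v) (reduceModP p w) := by
  simp only [reduceModP_apply, jkForm_apply, map_sub, map_mul, map_natCast]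

end Reduction

/-- The model of the Jonah–Konvisser group with `λ₁ = l`, `λ₂ = 1`: the vectors over `ZMod (p ^ 2)`
of length four, with addition twisted by `p • jkForm`. -/
abbrev JKModel (p l : ℕ) : Type := TwistedAddition (p := p) (jkForm (ZMod (p ^ 2)) l)

namespace JKModel

variable {p l : ℕ}

theorem card_eq (p l : ℕ) : Nat.card (JKModel p l) = p ^ 8 := by
  let e : JKModel p l ≃ (ZMod (p ^ 2) × ZMod (p ^ 2) × ZMod (p ^ 2) × ZMod (p ^ 2)) :=
    ⟨fun v => v.vec, fun v => ⟨v⟩, fun _ => rfl, fun _ => rfl⟩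
  rw [Nat.card_congr e]
  simp only [Nat.card_prod, Nat.card_zmod]
  ring

/-- The projection to the central quotient, which is a vector space over `ZMod p`. -/
def toQuotient [NeZero p] (l : ℕ) :
    JKModel p l →* Multiplicative (ZMod p × ZMod p × ZMod p × ZMod p) where
  toFun v := Multiplicative.ofAdd (reduceModP p v.vec)
  map_one' := by rw [TwistedAddition.vec_one, map_zero]; rfl
  map_mul' v w := by
    rw [TwistedAddition.vec_mul, map_add (reduceModP p), map_add (reduceModP p),
      (reduceModP_eq_zero_iff_exists (_ • _)).2 ⟨_, rfl⟩, add_zero]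
    rfl

/-- The first standard basis vector, as an element of the model. -/
def a₁ (p l : ℕ) : JKModel p l := ⟨(1, 0, 0, 0)⟩

/-- The second standard basis vector, as an element of the model. -/
def a₂ (p l : ℕ) : JKModel p l := ⟨(0, 1, 0, 0)⟩

/-- The third standard basis vector, as an element of the model. -/
def b₁ (p l : ℕ) : JKModel p l := ⟨(0, 0, 1, 0)⟩

/-- The fourth standard basis vector, as an element of the model. -/
def b₂ (p l : ℕ) : JKModel p l := ⟨(0, 0, 0, 1)⟩

theorem a₁_pow (n : ℕ) : (a₁ p l ^ n).vec = ((n : ZMod (p ^ 2)), 0, 0, 0) := by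
  simp [TwistedAddition.vec_pow, a₁, jkForm_apply]

theorem a₂_pow (n : ℕ) : (a₂ p l ^ n).vec = (0, (n : ZMod (p ^ 2)), 0, 0) := by
  simp [TwistedAddition.vec_pow, a₂, jkForm_apply]

theorem b₁_pow (n : ℕ) : (b₁ p l ^ n).vec = (0, 0, (n : ZMod (p ^ 2)), 0) := by
  simp [TwistedAddition.vec_pow, b₁, jkForm_apply]

theorem b₂_pow (n : ℕ) : (b₂ p l ^ n).vec = (0, 0, 0, (n : ZMod (p ^ 2))) := by
  simp [TwistedAddition.vec_pow, b₂, jkForm_apply]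

theorem isJKSystem (p l : ℕ) : IsJKSystem p l (a₁ p l) (a₂ p l) (b₁ p l) (b₂ p l) where
  central := TwistedAddition.commutator_commutator
  pow_a₁ := by
    ext1; rw [a₁_pow, TwistedAddition.vec_commutator]
    simp [a₁, b₁, jkForm_apply]
  pow_a₂ := by
    ext1
    rw [a₂_pow, TwistedAddition.vec_commutator, TwistedAddition.vec_mul, b₁_pow]
    simp [a₁, b₂, jkForm_apply]
  pow_b₁ := by
    ext1
    rw [b₁_pow, TwistedAddition.vec_commutator, TwistedAddition.vec_mul]
    simp [a₂, b₁, b₂, jkForm_apply]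
  pow_b₂ := by
    ext1; rw [b₂_pow, TwistedAddition.vec_commutator]
    simp [a₂, b₂, jkForm_apply]
  comm_a := by
    ext1; rw [TwistedAddition.vec_commutator]
    simp [a₁, a₂, jkForm_apply, TwistedAddition.vec_one]
  comm_b := by
    ext1; rw [TwistedAddition.vec_commutator]
    simp [b₁, b₂, jkForm_apply, TwistedAddition.vec_one]

/-- The exponents in the normal form of `v` are the coordinates of `v - p • jkForm v v`. -/
theorem exists_pow_mul_eq [NeZero p] (v : JKModel p l) :
    ∃ i j k m : ℕ, a₁ p l ^ i * a₂ p l ^ j * (b₁ p l ^ k * b₂ p l ^ m) = v := by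
  obtain ⟨⟨x, x', y, y'⟩⟩ := v
  refine ⟨(x - p * (x * y - l * (x * y'))).val, (x' - p * (x * y')).val,
    (y - p * (x' * y)).val, (y' - p * (x' * y' - x' * y)).val, ?_⟩
  have hp := natCast_mul_self_zmod_sq p
  ext1
  simp only [TwistedAddition.vec_mul, a₁_pow, a₂_pow, b₁_pow, b₂_pow, ZMod.natCast_zmod_val,
    jkForm_apply]
  refine Prod.ext ?_ (Prod.ext ?_ (Prod.ext ?_ ?_)) <;> simp <;> grind

end JKModel

/-- The model satisfies the presentation and is generated by its basis, so it is an image of the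
presented group; by the normal form the latter is no larger. -/
theorem exists_mulEquiv_jkModel (p l : ℕ) [NeZero p] :
    Finite (JKGroup p l 1) ∧ Nonempty (JKGroup p l 1 ≃* JKModel p l) := by
  obtain ⟨Φ, h₁, h₂, h₃, h₄⟩ := (JKModel.isJKSystem p l).exists_hom
  obtain ⟨hfin, hcard⟩ :=
    (isJKSystem_presented p l).finite_and_card_le (closure_jkGroup_generators p l)
  have hsurj : Function.Surjective Φ := by
    intro v
    obtain ⟨i, j, k, m, rfl⟩ := JKModel.exists_pow_mul_eq v
    exact ⟨_, by rw [← h₁, ← h₂, ← h₃, ← h₄, ← map_pow, ← map_pow, ← map_pow, ← map_pow, ← map_mul,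
      ← map_mul, ← map_mul]⟩
  have heq : Nat.card (JKGroup p l 1) = Nat.card (JKModel p l) :=
    le_antisymm (hcard.trans_eq (JKModel.card_eq p l).symm) (Nat.card_le_card_of_surjective Φ hsurj)
  exact ⟨hfin, ⟨MulEquiv.ofBijective Φ ((Nat.bijective_iff_surjective_and_card Φ).2 ⟨hsurj, heq⟩)⟩⟩

/-! ### Endomorphisms of the Jonah–Konvisser groups and the squaring map -/

namespace JKModel

variable {p l : ℕ}

/-- Relations of the form `w ^ p = ⁅u, v⁆` become linear in the central quotient. -/
theorem reduceModP_eq_bracket_of_pow_eq [NeZero p] (hp : p.Prime) (h2 : p ≠ 2)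
    {u v w : JKModel p l} (h : w ^ p = ⁅u, v⁆) :
    reduceModP p w.vec = jkBracket _ l (reduceModP p u.vec) (reduceModP p v.vec) := by
  have h' := congrArg TwistedAddition.vec h
  rw [TwistedAddition.vec_pow_prime hp h2, TwistedAddition.vec_commutator, ← sub_eq_zero,
    ← smul_sub, ← reduceModP_eq_zero_iff_smul_eq_zero, map_sub, map_sub, reduceModP_jkForm,
    reduceModP_jkForm, sub_eq_zero] at h'
  exact h'

theorem bracket_eq_zero_of_commutator_eq_one [NeZero p] {u v : JKModel p l} (h : ⁅u, v⁆ = 1) :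
    jkBracket _ l (reduceModP p u.vec) (reduceModP p v.vec) = 0 := by
  have h' := congrArg TwistedAddition.vec h
  rw [TwistedAddition.vec_commutator, TwistedAddition.vec_one,
    ← reduceModP_eq_zero_iff_smul_eq_zero, map_sub, reduceModP_jkForm, reduceModP_jkForm] at h'
  exact h'

theorem reduceModP_mul [NeZero p] (v w : JKModel p l) :
    reduceModP p (v * w).vec = reduceModP p v.vec + reduceModP p w.vec :=
  congrArg Multiplicative.toAdd ((toQuotient l).map_mul v w)

theorem reduceModP_pow [NeZero p] (v : JKModel p l) (n : ℕ) :
    reduceModP p (v ^ n).vec = n • reduceModP p v.vec :=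
  congrArg Multiplicative.toAdd ((toQuotient l).map_pow v n)

end JKModel

/-- A homomorphism from the Jonah–Konvisser group to its model is trivial modulo the centre, or it
maps the generators to the standard basis modulo the centre. -/
theorem reduceModP_hom_eq_zero_or_basis {p l : ℕ} [NeZero p] (hp : p.Prime) (h2 : p ≠ 2)
    (ψ : JKGroup p l 1 →* JKModel p l) :
    (∀ g, reduceModP p (ψ g).vec = 0) ∨
    (reduceModP p (ψ (.of .a₁)).vec = (1, 0, 0, 0) ∧ reduceModP p (ψ (.of .a₂)).vec = (0, 1, 0, 0) ∧
      reduceModP p (ψ (.of .b₁)).vec = (0, 0, 1, 0) ∧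
      reduceModP p (ψ (.of .b₂)).vec = (0, 0, 0, 1)) := by
  have : Fact p.Prime := ⟨hp⟩
  have h := isJKSystem_presented p l
  have hrel : JKRelations (jkBracket (ZMod p) l) l (reduceModP p (ψ (.of .a₁)).vec)
      (reduceModP p (ψ (.of .a₂)).vec) (reduceModP p (ψ (.of .b₁)).vec)
      (reduceModP p (ψ (.of .b₂)).vec) := by
    refine ⟨?_, ?_, ?_, ?_, ?_, ?_⟩
    · apply JKModel.reduceModP_eq_bracket_of_pow_eq hp h2
      rw [← map_pow, h.pow_a₁, map_commutatorElement]
    · rw [Nat.cast_smul_eq_nsmul, ← JKModel.reduceModP_pow, ← JKModel.reduceModP_mul]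
      apply JKModel.reduceModP_eq_bracket_of_pow_eq hp h2
      rw [← map_pow, h.pow_a₂, map_commutatorElement, map_mul, map_pow]
    · rw [← JKModel.reduceModP_mul]
      apply JKModel.reduceModP_eq_bracket_of_pow_eq hp h2
      rw [← map_pow, h.pow_b₁, map_commutatorElement, map_mul]
    · apply JKModel.reduceModP_eq_bracket_of_pow_eq hp h2
      rw [← map_pow, h.pow_b₂, map_commutatorElement]
    · apply JKModel.bracket_eq_zero_of_commutator_eq_one
      rw [← map_commutatorElement, h.comm_a, map_one]
    · apply JKModel.bracket_eq_zero_of_commutator_eq_one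
      rw [← map_commutatorElement, h.comm_b, map_one]
  refine hrel.eq_zero_or_eq_basis.imp (fun h0 g => ?_) id
  obtain ⟨h₁, h₂, h₃, h₄⟩ := h0
  have : (JKModel.toQuotient l).comp ψ = 1 := by
    apply PresentedGroup.ext
    rintro (_ | _ | _ | _)
    exacts [congrArg Multiplicative.ofAdd h₁, congrArg Multiplicative.ofAdd h₂,
      congrArg Multiplicative.ofAdd h₃, congrArg Multiplicative.ofAdd h₄]
  exact congrArg Multiplicative.toAdd (DFunLike.congr_fun this g)

/-- Every endomorphism of the Jonah–Konvisser group either maps into the centre or induces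
the identity on the central quotient. -/
theorem endomorphism_reduceModP {p l : ℕ} [NeZero p] (hp : p.Prime) (h2 : p ≠ 2)
    (e : JKGroup p l 1 ≃* JKModel p l) (φ : JKGroup p l 1 →* JKGroup p l 1) :
    (∀ g, reduceModP p (e (φ g)).vec = 0) ∨
      ∀ g, reduceModP p (e (φ g)).vec = reduceModP p (e g).vec := by
  rcases reduceModP_hom_eq_zero_or_basis hp h2 (e.toMonoidHom.comp φ) with h | ⟨h₁, h₂, h₃, h₄⟩
  · exact Or.inl h
  rcases reduceModP_hom_eq_zero_or_basis hp h2 e.toMonoidHom with h | ⟨k₁, k₂, k₃, k₄⟩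
  · exact Or.inl fun g => h (φ g)
  refine Or.inr fun g => ?_
  have : (JKModel.toQuotient l).comp (e.toMonoidHom.comp φ) =
      (JKModel.toQuotient l).comp e.toMonoidHom := by
    apply PresentedGroup.ext
    rintro (_ | _ | _ | _)
    exacts [congrArg Multiplicative.ofAdd (h₁.trans k₁.symm),
      congrArg Multiplicative.ofAdd (h₂.trans k₂.symm),
      congrArg Multiplicative.ofAdd (h₃.trans k₃.symm),
      congrArg Multiplicative.ofAdd (h₄.trans k₄.symm)]
  exact congrArg Multiplicative.toAdd (DFunLike.congr_fun this g)

/-- No endomorphism carries a quotient of two distinct elements to the quotient of their squares. -/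
theorem eq_of_endomorphism_eq_sq {p l : ℕ} (hp : p.Prime) (h2 : p ≠ 2)
    (φ : JKGroup p l 1 →* JKGroup p l 1) (x y : JKGroup p l 1)
    (h : φ (y⁻¹ * x) = (y ^ 2)⁻¹ * x ^ 2) : x = y := by
  have : NeZero p := ⟨hp.ne_zero⟩
  have : Fact p.Prime := ⟨hp⟩
  obtain ⟨-, ⟨e⟩⟩ := exists_mulEquiv_jkModel p l
  have htwo : (2 : ZMod p) ≠ 0 := by
    intro h0
    have : ((2 : ℕ) : ZMod p) = 0 := by exact_mod_cast h0
    rw [ZMod.natCast_eq_zero_iff, Nat.prime_dvd_prime_iff_eq hp Nat.prime_two] at this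
    exact h2 this
  have two_smul_eq : ∀ r : ZMod p × ZMod p × ZMod p × ZMod p, 2 • r = 0 → r = 0 := by
    intro r hr
    rw [← Nat.cast_smul_eq_nsmul (ZMod p)] at hr
    exact (smul_eq_zero.1 hr).resolve_left (by exact_mod_cast htwo)
  obtain ⟨q, rfl⟩ : ∃ q, x = y * q := ⟨y⁻¹ * x, by group⟩
  rw [inv_mul_cancel_left] at h
  suffices hq : q = 1 by rw [hq, mul_one]
  have hend := endomorphism_reduceModP hp h2 e φ
  have hsq : reduceModP p (e (φ q)).vec = 2 • reduceModP p (e q).vec := by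
    have h' : y ^ 2 * φ q = (y * q) ^ 2 := by rw [h]; group
    have h'' := congrArg (fun g => reduceModP p (e g).vec) h'
    simp only [map_mul, map_pow, JKModel.reduceModP_mul, JKModel.reduceModP_pow, smul_add] at h''
    exact add_left_cancel h''
  -- modulo the centre, `φ q` is `0` or `q`, while the hypothesis makes it `2 • q`; as `p ≠ 2`,
  -- this shows that `q` is central
  have hq0 : reduceModP p (e q).vec = 0 := by
    rcases hend with h0 | h1
    · exact two_smul_eq _ (hsq.symm.trans (h0 q))
    · have h1q := h1 q
      rw [hsq, two_smul] at h1q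
      exact left_eq_add.1 h1q.symm
  obtain ⟨u, hu⟩ := (reduceModP_eq_zero_iff_exists _).1 hq0
  obtain ⟨g, hg⟩ := e.surjective ⟨u⟩
  -- as a central element, `q` is a `p`-th power, so `φ q` only depends on `φ` modulo the centre
  have hpow : g ^ p = q := by
    apply e.injective
    ext1
    rw [map_pow, TwistedAddition.vec_pow_prime hp h2, hg, hu]
  have hcomm : Commute q y := by
    rw [← commutatorElement_eq_one_iff_commute]
    apply e.injective
    ext1
    rw [map_commutatorElement, TwistedAddition.vec_commutator, map_one, TwistedAddition.vec_one,
      ← reduceModP_eq_zero_iff_smul_eq_zero, map_sub, reduceModP_jkForm, reduceModP_jkForm, hq0,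
      map_zero, map_zero, LinearMap.zero_apply, sub_zero]
  rw [hcomm.symm.mul_pow, inv_mul_cancel_left] at h
  have hφq : (e (φ q)).vec = (p : ZMod (p ^ 2)) • (e (φ g)).vec := by
    rw [← hpow, map_pow, map_pow, TwistedAddition.vec_pow_prime hp h2]
  rcases hend with h0 | h1
  · have hφ1 : φ q = 1 := by
      apply e.injective
      ext1
      rw [hφq, map_one, TwistedAddition.vec_one]
      exact (reduceModP_eq_zero_iff_smul_eq_zero _).1 (h0 g)
    have hg2 : reduceModP p (e (g ^ 2)).vec = 0 := by
      rw [reduceModP_eq_zero_iff_smul_eq_zero, ← TwistedAddition.vec_pow_prime hp h2, ← map_pow,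
        ← pow_mul, mul_comm, pow_mul, hpow, ← h, hφ1, map_one, TwistedAddition.vec_one]
    rw [map_pow, JKModel.reduceModP_pow] at hg2
    apply e.injective
    ext1
    rw [← hpow, map_pow, TwistedAddition.vec_pow_prime hp h2, map_one, TwistedAddition.vec_one]
    exact (reduceModP_eq_zero_iff_smul_eq_zero _).1 (two_smul_eq _ hg2)
  · have hφ1 : φ q = q := by
      apply e.injective
      ext1
      rw [hφq, ← hpow, map_pow, TwistedAddition.vec_pow_prime hp h2, ← sub_eq_zero, ← smul_sub,
        ← reduceModP_eq_zero_iff_smul_eq_zero, map_sub, h1, sub_self]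
    rw [hφ1, pow_two] at h
    exact left_eq_mul.1 h

/-- A group in which no endomorphism carries a quotient of distinct elements to the quotient of
their squares has the least possible approximabilities, as witnessed by the squaring map, altered
at the identity in the case of endomorphisms. -/
theorem endApp_eq_zero_and_affApp_eq_one {G : Type*} [Group G] [Finite G] [Nontrivial G]
    (hG : ∀ (φ : G →* G) (x y : G), φ (y⁻¹ * x) = (y ^ 2)⁻¹ * x ^ 2 → x = y) :
    endApp G = 0 ∧ affApp G = 1 := by
  classical
  constructor
  · obtain ⟨a, ha⟩ := exists_ne (1 : G)
    let f : G → G := fun x => if x = 1 then a else x ^ 2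
    obtain ⟨A, ⟨φ, hφ⟩, hA⟩ := exists_ncard_eq_app (endMaps_nonempty G) f
    have hempty : {x | A x = f x} = ∅ := by
      refine Set.eq_empty_of_forall_notMem fun x hx => ?_
      rw [Set.mem_ofPred_eq, hφ] at hx
      by_cases h1 : x = 1
      · subst h1
        exact ha (by simpa [f] using hx.symm)
      · exact h1 (hG φ x 1 (by simpa [f, h1] using hx))
    have := minApp_le_app (endMaps G) f
    rw [← hA, hempty, Set.ncard_empty] at this
    exact Nat.le_zero.1 this
  · refine le_antisymm ?_ (one_le_affApp G)
    obtain ⟨A, ⟨g, φ, hφ⟩, hA⟩ := exists_ncard_eq_app (affMaps_nonempty G) fun x => x ^ 2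
    refine (minApp_le_app (affMaps G) fun x => x ^ 2).trans (hA ▸ ?_)
    rw [Set.ncard_le_one_iff]
    intro x y hx hy
    rw [Set.mem_ofPred_eq, hφ] at hx hy
    apply hG φ
    rw [← hx, ← hy, map_mul, map_inv]
    group

theorem jkGroup_properties {p : ℕ} (l : ℕ) (hp : p.Prime) (h2 : p ≠ 2) :
    Finite (JKGroup p l 1) ∧ Nat.card (JKGroup p l 1) = p ^ 8 ∧
      endApp (JKGroup p l 1) = 0 ∧ affApp (JKGroup p l 1) = 1 := by
  have : NeZero p := ⟨hp.ne_zero⟩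
  obtain ⟨hfin, ⟨e⟩⟩ := exists_mulEquiv_jkModel p l
  have hcard : Nat.card (JKGroup p l 1) = p ^ 8 :=
    (Nat.card_congr e.toEquiv).trans (JKModel.card_eq p l)
  have : Nontrivial (JKGroup p l 1) := by
    rw [← Finite.one_lt_card_iff_nontrivial, hcard]
    exact Nat.one_lt_pow (by norm_num) hp.one_lt
  exact ⟨hfin, hcard, endApp_eq_zero_and_affApp_eq_one (eq_of_endomorphism_eq_sq hp h2)⟩

theorem frequently_endApp_eq_zero_and_affApp_eq_one :
    ∃ᶠ G : FiniteGrp.{u} in orderAtTop, endApp G = 0 ∧ affApp G = 1 := by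
  refine frequently_orderAtTop (P := fun m n => m = 0 ∧ n = 1) fun N => ?_
  obtain ⟨p, hNp, hp⟩ := Nat.exists_infinite_primes (N + 3)
  obtain ⟨hfin, hcard, h⟩ := jkGroup_properties 0 hp (by omega)
  refine ⟨JKGroup p 0 1, inferInstance, hfin, ?_, h⟩
  rw [hcard]
  exact (by omega : N ≤ p).trans (Nat.le_self_pow (by norm_num) p)

/-! ### Large orders, and the theorem -/

theorem card_elementaryAbelian (r : ℕ) :
    Nat.card (Multiplicative (Fin r → ZMod 2)) = 2 ^ r := by
  rw [Nat.card_congr Multiplicative.toAdd, Nat.card_fun]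
  simp

theorem frequently_le_endApp (N : ℕ) :
    ∃ᶠ G : FiniteGrp.{u} in orderAtTop, N ≤ endApp G := by
  refine frequently_orderAtTop (P := fun m _ => N ≤ m) fun k => ?_
  refine ⟨Multiplicative (Fin (max N k) → ZMod 2), inferInstance,
    Finite.of_equiv _ Multiplicative.ofAdd, ?_,
    (le_max_left N k).trans (le_endApp_elementaryAbelian _)⟩
  rw [card_elementaryAbelian]
  exact (le_max_right N k).trans Nat.lt_two_pow_self.le

theorem mainTheorem1 :
    -- (1) bounds for all finite groups, and the asymptotic consequence
    ((∀ (G : Type u) [Group G] [Finite G] [Nontrivial G],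
        (0 : ℝ) ≤ endApp G ∧
        (endApp G : ℝ) ≤
          (1 / Real.log 2 + 1 / Real.log (Nat.card G)) * Real.log (Nat.card G) ^ 2 ∧
        (1 : ℝ) ≤ affApp G ∧
        (affApp G : ℝ) ≤
          (1 / Real.log 2 + 2 / Real.log (Nat.card G)) * Real.log (Nat.card G) ^ 2) ∧
      (∀ (G : Type u) [Group G] [Finite G], endApp G ≤ affApp G) ∧
      (fun G : FiniteGrp.{u} => (affApp G : ℝ)) =o[orderAtTop]
        (fun G : FiniteGrp.{u} => (Nat.card G : ℝ))) ∧
    -- (2) the groups `(ℤ/2ℤ)^r`, and the limits superior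
    ((∀ r : ℕ, 1 ≤ r →
        Nat.card (Multiplicative (Fin r → ZMod 2)) = 2 ^ r ∧
        Real.logb 2 (Nat.card (Multiplicative (Fin r → ZMod 2))) ≤
          (endApp (Multiplicative (Fin r → ZMod 2)) : ℝ) ∧
        Real.logb 2 (Nat.card (Multiplicative (Fin r → ZMod 2))) + 1 ≤
          (affApp (Multiplicative (Fin r → ZMod 2)) : ℝ)) ∧
      limsup (fun G : FiniteGrp.{u} => (endApp G : ℕ∞)) orderAtTop = ⊤ ∧
      limsup (fun G : FiniteGrp.{u} => (affApp G : ℕ∞)) orderAtTop = ⊤) ∧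
    -- (3) the Jonah-Konvisser groups, and the limits inferior
    ((∀ p l : ℕ, p.Prime → p ≠ 2 → l < p →
        Finite (JKGroup p l 1) ∧
        Nat.card (JKGroup p l 1) = p ^ 8 ∧
        endApp (JKGroup p l 1) = 0 ∧
        affApp (JKGroup p l 1) = 1) ∧
      liminf (fun G : FiniteGrp.{u} => (endApp G : ℕ∞)) orderAtTop = 0 ∧
      liminf (fun G : FiniteGrp.{u} => (affApp G : ℕ∞)) orderAtTop = 1) := by
  have htop : ∀ x : ℕ∞, (∀ N : ℕ, (N : ℕ∞) ≤ x) → x = ⊤ := fun x h =>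
    ENat.eq_top_iff_forall_ge.2 h
  refine ⟨⟨fun G _ _ _ => ⟨Nat.cast_nonneg _, endApp_le_log G, by exact_mod_cast one_le_affApp G,
      affApp_le_log G⟩, fun G _ _ => endApp_le_affApp G, affApp_isLittleO_card⟩,
    ⟨fun r _ => ⟨card_elementaryAbelian r, ?_, ?_⟩, htop _ fun N => ?_, htop _ fun N => ?_⟩,
    ⟨fun p l hp h2 _ => jkGroup_properties l hp h2, ?_, le_antisymm ?_ ?_⟩⟩
  · rw [card_elementaryAbelian, Nat.cast_pow, Nat.cast_ofNat, Real.logb_pow,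
      Real.logb_self_eq_one one_lt_two, mul_one]
    exact_mod_cast le_endApp_elementaryAbelian r
  · rw [card_elementaryAbelian, Nat.cast_pow, Nat.cast_ofNat, Real.logb_pow,
      Real.logb_self_eq_one one_lt_two, mul_one]
    exact_mod_cast succ_le_affApp_elementaryAbelian r
  · exact le_limsup_of_frequently_le ((frequently_le_endApp N).mono fun G h => by exact_mod_cast h)
  · exact le_limsup_of_frequently_le ((frequently_le_endApp N).mono fun G h => by
      exact_mod_cast h.trans (endApp_le_affApp G))
  · exact le_antisymm (liminf_le_of_frequently_le
      (frequently_endApp_eq_zero_and_affApp_eq_one.mono fun G h => by simp [h.1])) zero_le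
  · exact liminf_le_of_frequently_le
      (frequently_endApp_eq_zero_and_affApp_eq_one.mono fun G h => by simp [h.2])
  · exact le_liminf_of_le (h := Eventually.of_forall fun G => by exact_mod_cast one_le_affApp G)

end
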